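/- For each sample size $n$ along a sequence tending to infinity, let $\mathbf X_p$ be an $n\times p$ real design matrix with linearly independent columns, and let $\mathbf X_i$ be an $n\times i$ matrix formed by $i$ of the $p$ columns of $\mathbf X_p$; here $p=p_n$ and $i=i_n$ may vary with $n$. Consider the nested normal linear models $$M_i:\ \mathbf y\sim N_n(\mathbf X_i\boldsymbol\alpha_i,\sigma_i^2\mathbf I_n),\qquad M_p:\ \mathbf y\sim N_n(\mathbf X_p\boldsymbol\beta_p,\sigma_p^2\mathbf I_n),\qquad \sigma_i,\sigma_p>0 .$$ Put $\mathbf H_j=\mathbf X_j(\mathbf X_j'\mathbf X_j)^{-1}\mathbf X_j'$ for $j=i,p$ and $\mathcal B_{ip}=\dfrac{\mathbf y'(\mathbf I_n-\mathbf H_p)\mathbf y}{\mathbf y'(\mathbf I_n-\mathbf H_i)\mathbf y}$. The Bayes factor for intrinsic priors of $M_p$ against $M_i$ is $$B_{pi}(\mathbf y)=\frac2\pi(p+1)^{(p-i)/2}\int_0^{\pi/2}\frac{\sin^{p-i}\varphi\,\bigl(n+(p+1)\sin^2\varphi\bigr)^{(n-p)/2}}{\bigl(n\mathcal B_{ip}+(p+1)\sin^2\varphi\bigr)^{(n-i)/2}}\,d\varphi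 ,$$ and the distance from $M_p$ (with parameters $\boldsymbol\beta_p,\sigma_p$) to $M_i$ is $$\delta_{pi}=\frac1{\sigma_p^2}\,\boldsymbol\beta_p'\,\frac{\mathbf X_p'(\mathbf I_n-\mathbf H_i)\mathbf X_p}{n}\,\boldsymbol\beta_p .$$ Suppose that $i=O(n^a)$ for some $0\le a<1$, that $p=O(n)$, and that $n/p$ converges to a real number $r>1$. For $r>1$ let $$\delta(r)=\frac{r-1}{(r+1)^{(r-1)/r}-1}-1 .$$ 1. For every sequence of parameters $(\boldsymbol\alpha_i,\sigma_i)$, when sampling from $M_i$, $B_{pi}(\mathbf y)\to0$ in probability as $n\to\infty$. 2. For every sequence of parameters $(\boldsymbol\beta_p,\sigma_p)$ for which $\delta=\lim_{n\to\infty}\delta_{pi}$ exists and is finite, when sampling from $M_p$: if $\delta>\delta(r)$, then $B_{pi}(\mathbf y)\to\infty$ in probability; if $\delta<\delta(r)$, then $B_{pi}(\mathbf y)\to0$ in probability. Moreover, the function $r\mapsto\delta(r)$ is strictly decreasing and convex on $(1,\infty)$, and $\lim_{r\to\infty}\delta(r)=0$. -/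

import Mathlib

open Filter Topology MeasureTheory ProbabilityTheory Asymptotics
open scoped Matrix

noncomputable section

namespace IntrinsicBF

/-- The hat matrix `H = X (Xᵀ X)⁻¹ Xᵀ` of a design matrix `X`. -/
def hatMatrix {n m : ℕ} (X : Matrix (Fin n) (Fin m) ℝ) : Matrix (Fin n) (Fin n) ℝ :=
  X * (Xᵀ * X)⁻¹ * Xᵀ

/-- The residual sum of squares `yᵀ (I - H) y`. -/
def rss {n m : ℕ} (X : Matrix (Fin n) (Fin m) ℝ) (y : Fin n → ℝ) : ℝ :=
  y ⬝ᵥ ((1 - hatMatrix X) *ᵥ y)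

/-- The submatrix of `X` formed by the columns that `e` selects: the design matrix of the
reduced model. -/
def subDesign {n p i : ℕ} (X : Matrix (Fin n) (Fin p) ℝ) (e : Fin i ↪ Fin p) :
    Matrix (Fin n) (Fin i) ℝ :=
  X.submatrix id e

/-- The statistic `RSS_p / RSS_i`. -/
def rssRatio {n p i : ℕ} (X : Matrix (Fin n) (Fin p) ℝ) (e : Fin i ↪ Fin p)
    (y : Fin n → ℝ) : ℝ :=
  rss X y / rss (subDesign X e) y

/-- The Bayes factor for intrinsic priors of the full model (design `X`) against the reduced
model (design `subDesign X e`) at the data `y`. -/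
def bayesFactor {n p i : ℕ} (X : Matrix (Fin n) (Fin p) ℝ) (e : Fin i ↪ Fin p)
    (y : Fin n → ℝ) : ℝ :=
  2 / Real.pi * ((p : ℝ) + 1) ^ (((p : ℝ) - (i : ℝ)) / 2) *
    ∫ φ in (0 : ℝ)..(Real.pi / 2),
      Real.sin φ ^ ((p : ℝ) - (i : ℝ)) *
          ((n : ℝ) + ((p : ℝ) + 1) * Real.sin φ ^ 2) ^ (((n : ℝ) - (p : ℝ)) / 2) /
        ((n : ℝ) * rssRatio X e y + ((p : ℝ) + 1) * Real.sin φ ^ 2) ^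
          (((n : ℝ) - (i : ℝ)) / 2)

/-- The distance `δ_{pi} = σ⁻² βᵀ (Xᵀ (I - H_i) X / n) β` from the full model with parameters
`β, σ` to the reduced model. -/
def modelDistance {n p i : ℕ} (X : Matrix (Fin n) (Fin p) ℝ) (e : Fin i ↪ Fin p)
    (β : Fin p → ℝ) (σ : ℝ) : ℝ :=
  1 / σ ^ 2 *
    (β ⬝ᵥ (((1 / (n : ℝ)) • (Xᵀ * (1 - hatMatrix (subDesign X e)) * X)) *ᵥ β))

/-- The normal law `N(X b, σ² I_n)` of the responses. -/
def samplingLaw {n m : ℕ} (X : Matrix (Fin n) (Fin m) ℝ) (b : Fin m → ℝ) (σ : ℝ) :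
    Measure (Fin n → ℝ) :=
  Measure.pi fun j => gaussianReal ((X *ᵥ b) j) (Real.toNNReal (σ ^ 2))

/-- `Z k → c` in probability, where `Z k` is computed from data with law `P k`. -/
def TendstoInProb {n : ℕ → ℕ} (P : ∀ k, Measure (Fin (n k) → ℝ))
    (Z : ∀ k, (Fin (n k) → ℝ) → ℝ) (c : ℝ) : Prop :=
  ∀ ε : ℝ, 0 < ε → Tendsto (fun k => P k {y | ε ≤ |Z k y - c|}) atTop (𝓝 0)

/-- `Z k → ∞` in probability, where `Z k` is computed from data with law `P k`. -/
def TendstoInProbAtTop {n : ℕ → ℕ} (P : ∀ k, Measure (Fin (n k) → ℝ))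
    (Z : ∀ k, (Fin (n k) → ℝ) → ℝ) : Prop :=
  ∀ K : ℝ, Tendsto (fun k => P k {y | Z k y ≤ K}) atTop (𝓝 0)

/-- The threshold function `δ(r)`. -/
def deltaBound (r : ℝ) : ℝ :=
  (r - 1) / ((r + 1) ^ ((r - 1) / r) - 1) - 1

end IntrinsicBF

end

/-! Put `q = 1/r`, `t = sin² φ`, `β = RSS_p / RSS_i`, and let `T(r) = (r+1)^((r-1)/r)`, which is
`thresholdPow r`. The integrand of the Bayes factor is the exponential of `n/2` times a quantity
close to `q log (q t) + (1-q) log (1 + q t) - log (β + q t)`. Its value at `t = 1`, that is at `φ =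
π/2`, decides: it is negative or positive according as `β` lies above or below the critical level
`(T(r) - 1)/r`. Above that level the endpoint value dominates the whole integrand, so the Bayes
factor decays exponentially (`abs_bayesFactor_le`); below it, a short interval near `π/2` already
makes the integral grow exponentially (`le_bayesFactor`).

Residual sums of squares are quadratic forms of orthogonal projections in Gaussian vectors. Such a
form is a sum of independent squares whose variance is at most a multiple of `σ²` times its mean, so
Chebyshev gives a law of large numbers (`tendstoInProb_quadForm`). Hence `β → (1 - 1/r)/(1 + δ)`
under the full model, and comparison with the critical level yields exactly `δ(r)`. The reduced
model is the case `δ = 0`, settled by `δ(r) > 0`.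

For the threshold function, `1 + δ(r)` is the reciprocal of the slope of `T` between `1` and `r`.
Since `T''' < 0` on `[1, ∞)`, this slope is strictly concave, so `δ` is strictly convex; a strictly
convex function with a finite limit at infinity is strictly decreasing. -/

noncomputable section

namespace IntrinsicBF

/-! ### The threshold function -/

/-- The numerator of the third derivative of `(x + 1) ^ ((x - 1) / x)`, as a polynomial in
`w = log (x + 1) / x` and `s = 1 / (x + 1)`, is negative. -/
lemma thirdDerivPoly_neg {s w : ℝ} (hs0 : 0 < s) (hs : s ≤ 1 / 2)
    (hw : w ≤ 7 / 10) (hws : 1 / 3 ≤ s → w ≤ 2 / 5 + 3 / 5 * s) :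
    w ^ 3 - (3 + 6 * s) * w ^ 2 + (15 * s + 6 * s ^ 2) * w - 2 * s - 11 * s ^ 2 < 0 := by
  rcases le_total s (1 / 3) with h | h
  -- For small `s` the bound on `w ^ 3` leaves a concave quadratic in `w`; `h3` says that its
  -- discriminant, divided by `s`, is negative.
  · have h1 : w ^ 3 ≤ 7 / 10 * w ^ 2 := by nlinarith [sq_nonneg w]
    have h2 : 0 < 23 / 10 + 6 * s := by linarith
    have h3 : 225 * s + 180 * s ^ 2 + 36 * s ^ 3 - (92 / 10 + 24 * s) * (2 + 11 * s) < 0 := by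
      nlinarith [mul_nonneg hs0.le (sub_nonneg.2 h), mul_nonneg hs0.le (sq_nonneg s), mul_nonneg (mul_nonneg hs0.le hs0.le) (sub_nonneg.2 h), sq_nonneg (1/3 - s)]
    have h4 : -(23 / 10 + 6 * s) * w ^ 2 + (15 * s + 6 * s ^ 2) * w - 2 * s - 11 * s ^ 2 < 0 := by
      have h5 : 4 * (23 / 10 + 6 * s) *
          (-(23 / 10 + 6 * s) * w ^ 2 + (15 * s + 6 * s ^ 2) * w - 2 * s - 11 * s ^ 2) < 0 := by
        have : 4 * (23 / 10 + 6 * s) *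
          (-(23 / 10 + 6 * s) * w ^ 2 + (15 * s + 6 * s ^ 2) * w - 2 * s - 11 * s ^ 2) =
          -(2 * (23 / 10 + 6 * s) * w - (15 * s + 6 * s ^ 2)) ^ 2 +
          s * (225 * s + 180 * s ^ 2 + 36 * s ^ 3 - (92 / 10 + 24 * s) * (2 + 11 * s)) := by ring
        rw [this]
        nlinarith [sq_nonneg (2 * (23 / 10 + 6 * s) * w - (15 * s + 6 * s ^ 2)),
          mul_pos hs0 (neg_pos.2 h3)]
      by_contra hc
      push Not at hc
      have := mul_nonneg (by linarith : 0 ≤ 4 * (23 / 10 + 6 * s)) hc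
      linarith
    linarith
  -- For `s` in `[1/3, 1/2]` the cubic at `w` is at most its value at the upper bound `v` of `w`,
  -- and there it is a polynomial in `s` alone.
  · have hW := hws h
    set v := 2 / 5 + 3 / 5 * s with hv
    have hmono : w ^ 3 - (3 + 6 * s) * w ^ 2 + (15 * s + 6 * s ^ 2) * w ≤
        v ^ 3 - (3 + 6 * s) * v ^ 2 + (15 * s + 6 * s ^ 2) * v := by
      have hfac : v ^ 3 - (3 + 6 * s) * v ^ 2 + (15 * s + 6 * s ^ 2) * v -
          (w ^ 3 - (3 + 6 * s) * w ^ 2 + (15 * s + 6 * s ^ 2) * w) =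
          (v - w) * (v ^ 2 + v * w + w ^ 2 - (3 + 6 * s) * (v + w) + (15 * s + 6 * s ^ 2)) := by
        ring
      have : 0 ≤ v ^ 2 + v * w + w ^ 2 - (3 + 6 * s) * (v + w) + (15 * s + 6 * s ^ 2) := by
        have hvv : v ≤ 7 / 10 := by linarith
        have : v ^ 2 + v * w + w ^ 2 - (3 + 6 * s) * (v + w) ≥
          3 * v ^ 2 - 2 * (3 + 6 * s) * v := by
          nlinarith [mul_nonneg (sub_nonneg.2 hW) (by linarith : 0 ≤ 3 + 6 * s - (2 * v + w))]
        have h2 : 0 ≤ 3 * v ^ 2 - 2 * (3 + 6 * s) * v + (15 * s + 6 * s ^ 2) := by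
          rw [hv]; nlinarith
        linarith
      nlinarith [mul_nonneg (sub_nonneg.2 hW) this]
    have hend : v ^ 3 - (3 + 6 * s) * v ^ 2 + (15 * s + 6 * s ^ 2) * v - 2 * s - 11 * s ^ 2 < 0 := by
      rw [hv]; nlinarith [mul_nonneg (sub_nonneg.2 h) (sub_nonneg.2 hs), mul_nonneg (mul_nonneg (sub_nonneg.2 h) (sub_nonneg.2 hs)) hs0.le]
    linarith

/-- The first derivative of `(x - 1) / x * log (x + 1)`. -/
def expoDeriv (x : ℝ) : ℝ := Real.log (x + 1) / x ^ 2 + (x - 1) / (x * (x + 1))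

/-- The second derivative of `(x - 1) / x * log (x + 1)`. -/
def expoDeriv₂ (x : ℝ) : ℝ :=
  (x + 3) / (x * (x + 1) ^ 2) - 2 * Real.log (x + 1) / x ^ 3 - 2 * (x - 1) / (x ^ 2 * (x + 1))

/-- The third derivative of `(x - 1) / x * log (x + 1)`. -/
def expoDeriv₃ (x : ℝ) : ℝ :=
  6 * Real.log (x + 1) / x ^ 4 + 6 * (x - 1) / (x ^ 3 * (x + 1)) - 2 * (x + 3) / (x ^ 2 * (x + 1) ^ 2)
    - (2 * x ^ 2 + 9 * x + 3) / (x ^ 2 * (x + 1) ^ 3)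

/-- The power `(x + 1) ^ ((x - 1) / x)`. -/
def thresholdPow (x : ℝ) : ℝ := (x + 1) ^ ((x - 1) / x)

lemma thresholdPow_pos {x : ℝ} (hx : 0 < x) : 0 < thresholdPow x :=
  Real.rpow_pos_of_pos (by linarith) _

lemma thresholdPow_one : thresholdPow 1 = 1 := by simp [thresholdPow]

lemma one_lt_thresholdPow {x : ℝ} (hx : 1 < x) : 1 < thresholdPow x :=
  Real.one_lt_rpow (by linarith) (div_pos (by linarith) (by linarith))

lemma hasDerivAt_log_add_one {x : ℝ} (hx : 0 < x) :
    HasDerivAt (fun y : ℝ => Real.log (y + 1)) (1 / (x + 1)) x := by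
  simpa using ((hasDerivAt_id x).add_const 1).log (by simp; linarith)

lemma hasDerivAt_thresholdPow {x : ℝ} (hx : 0 < x) :
    HasDerivAt thresholdPow (thresholdPow x * expoDeriv x) x := by
  have hx1 : x + 1 ≠ 0 := by linarith
  have h := ((hasDerivAt_id x).add_const 1).rpow
    (((hasDerivAt_id x).sub_const 1).div (hasDerivAt_id x) hx.ne') (by simp; linarith)
  refine h.congr_deriv ?_
  simp only [id, Pi.div_apply]
  rw [Real.rpow_sub_one hx1, thresholdPow, expoDeriv]
  field_simp
  ring

lemma hasDerivAt_expoDeriv {x : ℝ} (hx : 0 < x) :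
    HasDerivAt expoDeriv (expoDeriv₂ x) x := by
  have hx1 : x + 1 ≠ 0 := by linarith
  have h := ((hasDerivAt_log_add_one hx).div ((hasDerivAt_id x).pow 2) (by simp [hx.ne'])).add
    (((hasDerivAt_id x).sub_const 1).div ((hasDerivAt_id x).mul ((hasDerivAt_id x).add_const 1))
      (mul_ne_zero hx.ne' hx1))
  refine h.congr_deriv ?_
  simp only [id, expoDeriv₂, Pi.pow_apply, Pi.mul_apply]
  field_simp
  ring

lemma hasDerivAt_expoDeriv₂ {x : ℝ} (hx : 0 < x) :
    HasDerivAt expoDeriv₂ (expoDeriv₃ x) x := by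
  have hx1 : x + 1 ≠ 0 := by linarith
  have hid := hasDerivAt_id x
  have h := (((hid.add_const 3).div (hid.mul ((hid.add_const 1).pow 2))
      (mul_ne_zero hx.ne' (pow_ne_zero 2 hx1))).sub
    (((hasDerivAt_log_add_one hx).const_mul 2).div (hid.pow 3) (by simp [hx.ne']))).sub
    (((hid.sub_const 1).const_mul 2).div ((hid.pow 2).mul (hid.add_const 1))
      (mul_ne_zero (pow_ne_zero 2 hx.ne') hx1))
  refine h.congr_deriv ?_
  simp only [id, expoDeriv₃, Pi.pow_apply, Pi.mul_apply]
  field_simp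
  ring

/-- Tangent line of `log` at `2`, together with `log 2 < 7/10`. -/
lemma log_add_one_div_le_of_one_le {x : ℝ} (hx : 1 ≤ x) :
    Real.log (x + 1) / x ≤ 1 / 2 + 1 / 5 / x := by
  have h1 : Real.log (x + 1) = Real.log 2 + Real.log ((x + 1) / 2) := by
    rw [← Real.log_mul (by norm_num) (by linarith)]; congr 1; ring
  have h2 := Real.log_le_sub_one_of_pos (x := (x + 1) / 2) (by linarith)
  have h3 := Real.log_two_lt_d9
  rw [div_add_div _ _ (by norm_num) (by linarith), div_le_div_iff₀ (by linarith) (by linarith)]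
  nlinarith

/-- The left side is `T'''/T` written through the logarithmic derivative `g = expoDeriv` as `g³ + 3
g g' + g''`. It equals `x⁻³` times the polynomial of `thirdDerivPoly_neg`. -/
lemma thirdDeriv_thresholdPow_neg {x : ℝ} (hx : 1 ≤ x) :
    expoDeriv x ^ 3 + 3 * expoDeriv x * expoDeriv₂ x + expoDeriv₃ x < 0 := by
  have hx0 : 0 < x := by linarith
  have hx1 : x + 1 ≠ 0 := by linarith
  have hw := log_add_one_div_le_of_one_le hx
  have hle : Real.log (x + 1) / x ≤ 7 / 10 := by
    have : 1 / 5 / x ≤ 1 / 5 := div_le_self (by norm_num) hx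
    linarith
  have hs : 1 / (x + 1) ≤ 1 / 2 := one_div_le_one_div_of_le (by norm_num) (by linarith)
  have key := thirdDerivPoly_neg (s := 1 / (x + 1)) (w := Real.log (x + 1) / x)
    (by positivity) hs hle (fun h => hw.trans ?_)
  · have : expoDeriv x ^ 3 + 3 * expoDeriv x * expoDeriv₂ x + expoDeriv₃ x =
      ((Real.log (x + 1) / x) ^ 3 - (3 + 6 * (1 / (x + 1))) * (Real.log (x + 1) / x) ^ 2 +
        (15 * (1 / (x + 1)) + 6 * (1 / (x + 1)) ^ 2) * (Real.log (x + 1) / x) -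
        2 * (1 / (x + 1)) - 11 * (1 / (x + 1)) ^ 2) / x ^ 3 := by
      rw [expoDeriv, expoDeriv₂, expoDeriv₃]
      field_simp
      ring
    rw [this]
    exact div_neg_of_neg_of_pos key (by positivity)
  · have hx2 : x ≤ 2 := by
      rw [div_le_div_iff₀ (by norm_num) (by linarith)] at h
      linarith
    -- The affine function of `1/(x+1)` agrees with `1/2 + 1/(5x)` at `x = 1` and `x = 2`, whence
    -- the two factors.
    have : 2 / 5 + 3 / 5 * (1 / (x + 1)) - (1 / 2 + 1 / 5 / x) =
        (2 - x) * (x - 1) / (10 * x * (x + 1)) := by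
      field_simp
      ring
    have h2 : 0 ≤ (2 - x) * (x - 1) / (10 * x * (x + 1)) :=
      div_nonneg (mul_nonneg (by linarith) (by linarith)) (by positivity)
    linarith

/-- The slope of `thresholdPow` between `1` and `x`. -/
def thresholdSlope (x : ℝ) : ℝ := (thresholdPow x - 1) / (x - 1)

lemma thresholdSlope_pos {x : ℝ} (hx : 1 < x) : 0 < thresholdSlope x :=
  div_pos (by linarith [one_lt_thresholdPow hx]) (by linarith)

lemma hasDerivAt_thresholdPow_deriv {x : ℝ} (hx : 0 < x) :
    HasDerivAt (fun y => thresholdPow y * expoDeriv y)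
      (thresholdPow x * (expoDeriv x ^ 2 + expoDeriv₂ x)) x := by
  refine ((hasDerivAt_thresholdPow hx).mul (hasDerivAt_expoDeriv hx)).congr_deriv ?_
  ring

lemma hasDerivAt_thresholdPow_deriv₂ {x : ℝ} (hx : 0 < x) :
    HasDerivAt (fun y => thresholdPow y * (expoDeriv y ^ 2 + expoDeriv₂ y))
      (thresholdPow x * (expoDeriv x ^ 3 + 3 * expoDeriv x * expoDeriv₂ x + expoDeriv₃ x)) x := by
  refine ((hasDerivAt_thresholdPow hx).mul
    (((hasDerivAt_expoDeriv hx).pow 2).add (hasDerivAt_expoDeriv₂ hx))).congr_deriv ?_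
  simp
  ring

/-- The numerator of the second derivative of `thresholdSlope`. -/
def slopeNumerator (x : ℝ) : ℝ :=
  thresholdPow x * (expoDeriv x ^ 2 + expoDeriv₂ x) * (x - 1) ^ 2 -
    2 * (thresholdPow x * expoDeriv x) * (x - 1) + 2 * (thresholdPow x - 1)

lemma hasDerivAt_slopeNumerator {x : ℝ} (hx : 0 < x) :
    HasDerivAt slopeNumerator
      (thresholdPow x * (expoDeriv x ^ 3 + 3 * expoDeriv x * expoDeriv₂ x + expoDeriv₃ x) *
        (x - 1) ^ 2) x := by
  have hid := (hasDerivAt_id x).sub_const 1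
  refine ((((hasDerivAt_thresholdPow_deriv₂ hx).mul (hid.pow 2)).sub
    (((hasDerivAt_thresholdPow_deriv hx).const_mul 2).mul hid)).add
    (((hasDerivAt_thresholdPow hx).sub_const 1).const_mul 2)).congr_deriv ?_
  simp
  ring

/-- The numerator vanishes at `1`, and its derivative is `T'''(x) (x-1)²`: the lower derivatives of
`T` cancel. -/
lemma slopeNumerator_neg {x : ℝ} (hx : 1 < x) : slopeNumerator x < 0 := by
  have hanti : StrictAntiOn slopeNumerator (Set.Ici 1) := by
    refine strictAntiOn_of_deriv_neg (convex_Ici 1) (fun y hy => ?_) (fun y hy => ?_)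
    · exact (hasDerivAt_slopeNumerator (by linarith [Set.mem_Ici.1 hy])).continuousAt.continuousWithinAt
    · rw [interior_Ici] at hy
      have hy : 1 < y := hy
      rw [(hasDerivAt_slopeNumerator (by linarith)).deriv]
      exact mul_neg_of_neg_of_pos (mul_neg_of_pos_of_neg (thresholdPow_pos (by linarith))
        (thirdDeriv_thresholdPow_neg hy.le)) (by have := sub_pos.2 hy; positivity)
  have := hanti (Set.mem_Ici.2 le_rfl) (Set.mem_Ici.2 hx.le) hx
  simpa [slopeNumerator, thresholdPow_one] using this

lemma hasDerivAt_thresholdSlope {x : ℝ} (hx : 1 < x) :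
    HasDerivAt thresholdSlope
      ((thresholdPow x * expoDeriv x * (x - 1) - (thresholdPow x - 1)) / (x - 1) ^ 2) x := by
  refine (((hasDerivAt_thresholdPow (by linarith)).sub_const 1).div
    ((hasDerivAt_id x).sub_const 1) (by simp; linarith)).congr_deriv ?_
  simp

lemma strictConcaveOn_thresholdSlope : StrictConcaveOn ℝ (Set.Ioi 1) thresholdSlope := by
  refine strictConcaveOn_of_deriv2_neg (convex_Ioi 1)
    (fun x hx => (hasDerivAt_thresholdSlope hx).continuousAt.continuousWithinAt) fun x hx => ?_
  rw [interior_Ioi] at hx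
  have hx : 1 < x := hx
  have hx1 : x - 1 ≠ 0 := by linarith
  have hev : deriv thresholdSlope =ᶠ[𝓝 x] fun x =>
      (thresholdPow x * expoDeriv x * (x - 1) - (thresholdPow x - 1)) / (x - 1) ^ 2 := by
    filter_upwards [lt_mem_nhds hx] with y hy using (hasDerivAt_thresholdSlope hy).deriv
  have hid := (hasDerivAt_id x).sub_const 1
  have hd : HasDerivAt (fun x =>
      (thresholdPow x * expoDeriv x * (x - 1) - (thresholdPow x - 1)) / (x - 1) ^ 2)
      (slopeNumerator x / (x - 1) ^ 3) x := by
    refine ((((hasDerivAt_thresholdPow_deriv (by linarith)).mul hid).sub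
      ((hasDerivAt_thresholdPow (by linarith)).sub_const 1)).div (hid.pow 2)
      (pow_ne_zero 2 hx1)).congr_deriv ?_
    simp [slopeNumerator]
    field_simp
    ring
  rw [Function.iterate_succ_apply, Function.iterate_one, hev.deriv_eq, hd.deriv]
  exact div_neg_of_neg_of_pos (slopeNumerator_neg hx) (by have := sub_pos.2 hx; positivity)

lemma deltaBound_eq (r : ℝ) : deltaBound r = (thresholdSlope r)⁻¹ - 1 := by
  simp [deltaBound, thresholdSlope, thresholdPow]

/-- The reciprocal is convex and decreasing on the positive axis, so it turns the positive strictly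
concave slope into a strictly convex function. -/
lemma strictConvexOn_deltaBound : StrictConvexOn ℝ (Set.Ioi 1) deltaBound := by
  refine ⟨convex_Ioi 1, fun x hx y hy hxy a b ha hb hab => ?_⟩
  have h1 := strictConcaveOn_thresholdSlope.2 hx hy hxy ha hb hab
  have hx0 := thresholdSlope_pos hx
  have hy0 := thresholdSlope_pos hy
  simp only [deltaBound_eq, smul_eq_mul] at *
  have h2 : 0 < a * thresholdSlope x + b * thresholdSlope y := by positivity
  have h3 : (a * thresholdSlope x + b * thresholdSlope y)⁻¹ ≤
      a * (thresholdSlope x)⁻¹ + b * (thresholdSlope y)⁻¹ := by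
    have := (convexOn_zpow (-1)).2 (Set.mem_Ioi.2 hx0) (Set.mem_Ioi.2 hy0) ha.le hb.le hab
    simpa [zpow_neg_one] using this
  have h4 := inv_strictAnti₀ h2 h1
  calc _ < a * (thresholdSlope x)⁻¹ + b * (thresholdSlope y)⁻¹ - 1 := by linarith
    _ = _ := by linear_combination hab

lemma tendsto_deltaBound : Tendsto deltaBound atTop (𝓝 0) := by
  have h1 : Tendsto (fun r : ℝ => (r + 1) ^ (-1 / r)) atTop (𝓝 1) := by
    have h2 := (tendsto_rpow_div_mul_add (-1) 1 (-1) zero_ne_one).comp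
      (tendsto_atTop_add_const_right atTop (1 : ℝ) tendsto_id)
    refine h2.congr fun r => ?_
    simp
  have hinv : Tendsto (fun r : ℝ => r⁻¹) atTop (𝓝 0) := tendsto_inv_atTop_zero
  have h2 : Tendsto (fun r : ℝ => (1 - r⁻¹) / ((1 + r⁻¹) * (r + 1) ^ (-1 / r) - r⁻¹) - 1) atTop
      (𝓝 ((1 - 0) / ((1 + 0) * 1 - 0) - 1)) :=
    (((tendsto_const_nhds.sub hinv).div (((tendsto_const_nhds.add hinv).mul h1).sub hinv)
      (by norm_num)).sub tendsto_const_nhds)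
  norm_num at h2
  refine h2.congr' ?_
  filter_upwards [eventually_gt_atTop 1] with r hr
  have hr0 : r ≠ 0 := by linarith
  have hr1 : 0 < r + 1 := by linarith
  have h3 : (r + 1) ^ ((r - 1) / r) = (r + 1) * (r + 1) ^ (-1 / r) := by
    rw [sub_div, div_self hr0, sub_eq_add_neg, Real.rpow_add hr1, Real.rpow_one, neg_div]
  rw [deltaBound, h3, ← mul_div_mul_left (1 - r⁻¹) _ hr0]
  congr 2
  · field_simp
  · field_simp

/-- By convexity the value at `y` lies below the chord from `x` to `z`; as `z → ∞` the chord height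
at `y` tends to the value at `x`, because the values at `z` stay bounded. Strictness comes from
strict convexity at `y`, the midpoint of `x` and `2y - x`. -/
lemma strictAntiOn_deltaBound : StrictAntiOn deltaBound (Set.Ioi 1) := by
  have hanti : ∀ x y, 1 < x → x < y → deltaBound y ≤ deltaBound x := by
    intro x y hx hxy
    have hlim : Tendsto (fun z => (z - y) / (z - x) * deltaBound x +
        (y - x) / (z - x) * deltaBound z) atTop (𝓝 (1 * deltaBound x + 0 * 0)) := by
      have h0 : Tendsto (fun z : ℝ => (y - x) / (z - x)) atTop (𝓝 0) :=
        Tendsto.const_div_atTop (tendsto_atTop_add_const_right _ (-x) tendsto_id) _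
      have h1 : Tendsto (fun z : ℝ => (z - y) / (z - x)) atTop (𝓝 1) := by
        have := (tendsto_const_nhds (x := (1 : ℝ))).sub h0
        rw [sub_zero] at this
        refine this.congr' ?_
        filter_upwards [eventually_gt_atTop x] with z hz
        have : z - x ≠ 0 := by linarith
        field_simp
        ring
      exact (h1.mul_const _).add (h0.mul tendsto_deltaBound)
    simp only [one_mul, mul_zero, add_zero] at hlim
    refine ge_of_tendsto hlim ?_
    filter_upwards [eventually_gt_atTop y] with z hz
    have hzx : 0 < z - x := by linarith
    have hz1 : z ∈ Set.Ioi (1 : ℝ) := show 1 < z by linarith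
    have hx1 : x ∈ Set.Ioi (1 : ℝ) := hx
    have ha : 0 ≤ (z - y) / (z - x) := div_nonneg (by linarith) hzx.le
    have hb : 0 ≤ (y - x) / (z - x) := div_nonneg (by linarith) hzx.le
    have := strictConvexOn_deltaBound.convexOn.2 hx1 hz1 ha hb (by field_simp; ring)
    simp only [smul_eq_mul] at this
    convert! this using 2
    field_simp
    ring
  intro x hx y hy hxy
  have hx0 : 1 < x := hx
  have hz : 2 * y - x ∈ Set.Ioi (1 : ℝ) := show 1 < 2 * y - x by linarith
  have hhalf : (0 : ℝ) < 1 / 2 := by norm_num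
  have h := strictConvexOn_deltaBound.2 hx hz (by linarith) hhalf hhalf (by norm_num)
  have h2 := hanti y (2 * y - x) hy (by linarith)
  have h3 : (1 / 2 : ℝ) • x + (1 / 2 : ℝ) • (2 * y - x) = y := by simp; ring
  rw [h3] at h
  simp only [smul_eq_mul] at h
  linarith

lemma deltaBound_pos {r : ℝ} (hr : 1 < r) : 0 < deltaBound r := by
  have h1 := strictAntiOn_deltaBound (show 1 < r from hr) (show 1 < r + 1 by linarith)
    (by linarith)
  refine lt_of_le_of_lt (le_of_tendsto tendsto_deltaBound ?_) h1
  filter_upwards [eventually_gt_atTop (r + 1)] with z hz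
  exact (strictAntiOn_deltaBound (show 1 < r + 1 by linarith) (show 1 < z by linarith) hz).le

/-! ### Deterministic bounds for the Bayes factor -/

/-- The integrand of the Bayes factor, with the power of `p + 1` included, is an exponential. -/
lemma rpow_mul_integrand_eq_exp {N P a b β s : ℝ} (hN : 0 < N) (hP : 0 < P) (hβ : 0 < β)
    (hs : 0 < s) :
    P ^ (a / 2) * (s ^ a * (N + P * s ^ 2) ^ (b / 2) / (N * β + P * s ^ 2) ^ ((a + b) / 2)) =
      Real.exp ((a * Real.log (P * s ^ 2) + b * Real.log (N + P * s ^ 2) -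
        (a + b) * Real.log (N * β + P * s ^ 2)) / 2) := by
  have h1 : 0 < N + P * s ^ 2 := by positivity
  have h2 : 0 < N * β + P * s ^ 2 := by positivity
  rw [Real.rpow_def_of_pos hP, Real.rpow_def_of_pos hs, Real.rpow_def_of_pos h1,
    Real.rpow_def_of_pos h2, ← Real.exp_add, ← Real.exp_sub, ← Real.exp_add,
    Real.log_mul hP.ne' (by positivity), Real.log_pow]
  congr 1
  push_cast
  ring

/-- Lowering `β` to `β₀` only raises the left side. Then `log u ≤ u - 1`, applied to the ratios of
the terms at `t` and at `1` with weights `a` and `b`, leaves a negative multiple of `(1 - t)` times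
the expression in `hmono`. That hypothesis says that the exponent has nonnegative `t`-derivative at
`t = 1`. -/
lemma integrand_exponent_le {N P a b β β₀ t : ℝ} (hN : 0 < N) (hP : 0 < P) (ha : 0 ≤ a)
    (hb : 0 ≤ b) (hβ₀ : 0 < β₀) (hβ : β₀ ≤ β) (ht : 0 < t) (ht1 : t ≤ 1)
    (hmono : 0 ≤ a * β₀ * (N + P) + b * (β₀ - 1) * P) :
    a * Real.log (P * t) + b * Real.log (N + P * t) - (a + b) * Real.log (N * β + P * t) ≤
      a * Real.log P + b * Real.log (N + P) - (a + b) * Real.log (N * β₀ + P) := by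
  have hPt : 0 < P * t := by positivity
  have hNPt : 0 < N + P * t := by positivity
  have hD : 0 < N * β₀ + P * t := by positivity
  have hD0 : 0 < N * β₀ + P := by positivity
  have hNP : 0 < N + P := by positivity
  have h1 : Real.log (N * β₀ + P * t) ≤ Real.log (N * β + P * t) :=
    Real.log_le_log hD (by gcongr)
  have hu := Real.log_le_sub_one_of_pos
    (show 0 < P * t * (N * β₀ + P) / (P * (N * β₀ + P * t)) by positivity)
  have hv := Real.log_le_sub_one_of_pos
    (show 0 < (N + P * t) * (N * β₀ + P) / ((N + P) * (N * β₀ + P * t)) by positivity)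
  rw [Real.log_div (by positivity) (by positivity), Real.log_mul hPt.ne' hD0.ne',
    Real.log_mul hP.ne' hD.ne'] at hu
  rw [Real.log_div (by positivity) (by positivity), Real.log_mul hNPt.ne' hD0.ne',
    Real.log_mul hNP.ne' hD.ne'] at hv
  have hsum : a * (P * t * (N * β₀ + P) / (P * (N * β₀ + P * t)) - 1) +
      b * ((N + P * t) * (N * β₀ + P) / ((N + P) * (N * β₀ + P * t)) - 1) =
      -(N * (1 - t) * (a * β₀ * (N + P) + b * (β₀ - 1) * P)) /
        ((N + P) * (N * β₀ + P * t)) := by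
    field_simp
    ring
  have hneg : -(N * (1 - t) * (a * β₀ * (N + P) + b * (β₀ - 1) * P)) /
        ((N + P) * (N * β₀ + P * t)) ≤ 0 :=
    div_nonpos_of_nonpos_of_nonneg
      (neg_nonpos.2 (mul_nonneg (mul_nonneg hN.le (by linarith)) hmono)) (by positivity)
  have h2 := mul_le_mul_of_nonneg_left hu ha
  have h3 := mul_le_mul_of_nonneg_left hv hb
  have h4 := mul_le_mul_of_nonneg_left h1 (add_nonneg ha hb)
  linarith

variable {n p i : ℕ}

/-- Writing `n - i` as `(p - i) + (n - p)` gives the shape required by `rpow_mul_integrand_eq_exp`.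
-/
lemma bayesFactor_eq (X : Matrix (Fin n) (Fin p) ℝ) (e : Fin i ↪ Fin p) (y : Fin n → ℝ) :
    bayesFactor X e y = 2 / Real.pi * ∫ φ in (0 : ℝ)..(Real.pi / 2),
      ((p : ℝ) + 1) ^ (((p : ℝ) - i) / 2) * (Real.sin φ ^ ((p : ℝ) - i) *
          ((n : ℝ) + ((p : ℝ) + 1) * Real.sin φ ^ 2) ^ (((n : ℝ) - p) / 2) /
        ((n : ℝ) * rssRatio X e y + ((p : ℝ) + 1) * Real.sin φ ^ 2) ^
          ((((p : ℝ) - i) + ((n : ℝ) - p)) / 2)) := by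
  rw [intervalIntegral.integral_const_mul, ← mul_assoc, bayesFactor]
  ring_nf

lemma abs_bayesFactor_le (X : Matrix (Fin n) (Fin p) ℝ) (e : Fin i ↪ Fin p) (y : Fin n → ℝ)
    (hn : 0 < n) (hip : i ≤ p) (hpn : p ≤ n) {β₀ : ℝ} (hβ₀ : 0 < β₀) (hβ : β₀ ≤ rssRatio X e y)
    (hmono : 0 ≤ ((p : ℝ) - i) * β₀ * (n + (p + 1)) + ((n : ℝ) - p) * (β₀ - 1) * (p + 1)) :
    |bayesFactor X e y| ≤ Real.exp ((((p : ℝ) - i) * Real.log (p + 1) +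
      ((n : ℝ) - p) * Real.log (n + (p + 1)) -
      (((p : ℝ) - i) + ((n : ℝ) - p)) * Real.log (n * β₀ + (p + 1))) / 2) := by
  have hn' : (0 : ℝ) < n := by exact_mod_cast hn
  have ha : (0 : ℝ) ≤ (p : ℝ) - i := sub_nonneg.2 (by exact_mod_cast hip)
  have hb : (0 : ℝ) ≤ (n : ℝ) - p := sub_nonneg.2 (by exact_mod_cast hpn)
  have hP : (0 : ℝ) < (p : ℝ) + 1 := by positivity
  rw [bayesFactor_eq, abs_mul, abs_of_pos (by positivity : 0 < 2 / Real.pi)]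
  have hbound := intervalIntegral.norm_integral_le_of_norm_le_const (a := (0 : ℝ))
    (b := Real.pi / 2) (C := Real.exp ((((p : ℝ) - i) * Real.log (p + 1) +
      ((n : ℝ) - p) * Real.log (n + (p + 1)) -
      (((p : ℝ) - i) + ((n : ℝ) - p)) * Real.log (n * β₀ + (p + 1))) / 2))
    (f := fun φ => ((p : ℝ) + 1) ^ (((p : ℝ) - i) / 2) * (Real.sin φ ^ ((p : ℝ) - i) *
          ((n : ℝ) + ((p : ℝ) + 1) * Real.sin φ ^ 2) ^ (((n : ℝ) - p) / 2) /
        ((n : ℝ) * rssRatio X e y + ((p : ℝ) + 1) * Real.sin φ ^ 2) ^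
          ((((p : ℝ) - i) + ((n : ℝ) - p)) / 2))) ?_
  · rw [sub_zero, abs_of_pos (by positivity : 0 < Real.pi / 2), Real.norm_eq_abs] at hbound
    refine (mul_le_mul_of_nonneg_left hbound (by positivity)).trans_eq ?_
    field_simp
  · intro φ hφ
    rw [Set.uIoc_of_le (by positivity)] at hφ
    have hs : 0 < Real.sin φ := Real.sin_pos_of_pos_of_lt_pi hφ.1 (by linarith [hφ.2, Real.pi_pos])
    rw [rpow_mul_integrand_eq_exp hn' hP (hβ₀.trans_le hβ) hs, Real.norm_eq_abs, Real.abs_exp,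
      Real.exp_le_exp]
    have := integrand_exponent_le hn' hP ha hb hβ₀ hβ (pow_pos hs 2)
      (Real.sin_sq_le_one φ) hmono
    linarith

/-- The nonnegative part over `[0, ψ]` is dropped; on `[ψ, π/2]` the sine is at least `sin ψ` in the
numerator and at most `1` in the denominator. -/
lemma le_bayesFactor (X : Matrix (Fin n) (Fin p) ℝ) (e : Fin i ↪ Fin p) (y : Fin n → ℝ)
    (hn : 0 < n) (hip : i ≤ p) (hpn : p ≤ n) {β₁ ψ : ℝ} (hβ : 0 < rssRatio X e y)
    (hβ₁ : rssRatio X e y ≤ β₁) (hψ : 0 < ψ) (hψ' : ψ ≤ Real.pi / 2) :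
    2 / Real.pi * (Real.pi / 2 - ψ) * Real.exp ((((p : ℝ) - i) *
      Real.log ((p + 1) * Real.sin ψ ^ 2) +
      ((n : ℝ) - p) * Real.log (n + (p + 1) * Real.sin ψ ^ 2) -
      (((p : ℝ) - i) + ((n : ℝ) - p)) * Real.log (n * β₁ + (p + 1))) / 2) ≤
    bayesFactor X e y := by
  have hn' : (0 : ℝ) < n := by exact_mod_cast hn
  have ha : (0 : ℝ) ≤ (p : ℝ) - i := sub_nonneg.2 (by exact_mod_cast hip)
  have hb : (0 : ℝ) ≤ (n : ℝ) - p := sub_nonneg.2 (by exact_mod_cast hpn)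
  have hP : (0 : ℝ) < (p : ℝ) + 1 := by positivity
  have hsψ : 0 < Real.sin ψ := Real.sin_pos_of_pos_of_lt_pi hψ (by linarith [Real.pi_pos])
  rw [bayesFactor_eq, mul_assoc]
  refine mul_le_mul_of_nonneg_left ?_ (by positivity)
  set f : ℝ → ℝ := fun φ => ((p : ℝ) + 1) ^ (((p : ℝ) - i) / 2) * (Real.sin φ ^ ((p : ℝ) - i) *
          ((n : ℝ) + ((p : ℝ) + 1) * Real.sin φ ^ 2) ^ (((n : ℝ) - p) / 2) /
        ((n : ℝ) * rssRatio X e y + ((p : ℝ) + 1) * Real.sin φ ^ 2) ^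
          ((((p : ℝ) - i) + ((n : ℝ) - p)) / 2)) with hf
  have hpos1 : ∀ φ : ℝ, 0 < (n : ℝ) + ((p : ℝ) + 1) * Real.sin φ ^ 2 := fun φ => by positivity
  have hpos2 : ∀ φ : ℝ, 0 < (n : ℝ) * rssRatio X e y + ((p : ℝ) + 1) * Real.sin φ ^ 2 :=
    fun φ => by positivity
  have hcont : Continuous f := by
    refine continuous_const.mul (Continuous.div ?_ ?_ fun φ => (Real.rpow_pos_of_pos (hpos2 φ) _).ne')
    · refine (Real.continuous_sin.rpow_const fun _ => Or.inr ha).mul ?_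
      exact Continuous.rpow_const (by fun_prop) fun φ => Or.inl (hpos1 φ).ne'
    · exact Continuous.rpow_const (by fun_prop) fun φ => Or.inl (hpos2 φ).ne'
  have hnonneg : ∀ φ ∈ Set.Icc 0 (Real.pi / 2), 0 ≤ f φ := by
    intro φ hφ
    have : 0 ≤ Real.sin φ := Real.sin_nonneg_of_nonneg_of_le_pi hφ.1
      (by linarith [hφ.2, Real.pi_pos])
    have h1 := (hpos1 φ).le
    have h2 := (hpos2 φ).le
    simp only [hf]
    positivity
  have hsplit := intervalIntegral.integral_add_adjacent_intervals
    (hcont.intervalIntegrable (μ := volume) 0 ψ) (hcont.intervalIntegrable ψ (Real.pi / 2))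
  have hfirst : 0 ≤ ∫ φ in (0 : ℝ)..ψ, f φ :=
    intervalIntegral.integral_nonneg hψ.le fun φ hφ => hnonneg φ ⟨hφ.1, hφ.2.trans hψ'⟩
  have hsecond : ∫ φ in ψ..(Real.pi / 2), Real.exp ((((p : ℝ) - i) *
      Real.log ((p + 1) * Real.sin ψ ^ 2) +
      ((n : ℝ) - p) * Real.log (n + (p + 1) * Real.sin ψ ^ 2) -
      (((p : ℝ) - i) + ((n : ℝ) - p)) * Real.log (n * β₁ + (p + 1))) / 2) ≤
      ∫ φ in ψ..(Real.pi / 2), f φ := by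
    refine intervalIntegral.integral_mono_on hψ' (by simp) (hcont.intervalIntegrable _ _) ?_
    intro φ hφ
    have hle : Real.sin ψ ≤ Real.sin φ := Real.sin_le_sin_of_le_of_le_pi_div_two
      (by linarith [Real.pi_pos]) hφ.2 hφ.1
    have hs : 0 < Real.sin φ := hsψ.trans_le hle
    simp only [hf]
    rw [rpow_mul_integrand_eq_exp hn' hP hβ hs, Real.exp_le_exp]
    have h1 : Real.log ((p + 1) * Real.sin ψ ^ 2) ≤ Real.log ((p + 1) * Real.sin φ ^ 2) :=
      Real.log_le_log (by positivity) (by gcongr)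
    have h2 : Real.log (n + (p + 1) * Real.sin ψ ^ 2) ≤ Real.log (n + (p + 1) * Real.sin φ ^ 2) :=
      Real.log_le_log (by positivity) (by gcongr)
    have h3 : Real.log (n * rssRatio X e y + (p + 1) * Real.sin φ ^ 2) ≤
        Real.log (n * β₁ + (p + 1)) := by
      refine Real.log_le_log (by positivity) ?_
      have := mul_le_mul_of_nonneg_left (Real.sin_sq_le_one φ) hP.le
      have := mul_le_mul_of_nonneg_left hβ₁ hn'.le
      linarith
    have h4 := mul_le_mul_of_nonneg_left h1 ha
    have h5 := mul_le_mul_of_nonneg_left h2 hb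
    have h6 := mul_le_mul_of_nonneg_left h3 (add_nonneg ha hb)
    linarith
  rw [intervalIntegral.integral_const, smul_eq_mul] at hsecond
  linarith

/-! ### The exponential rate of the Bayes factor -/

/-- The limit of `2 / n` times the logarithm of the lower bound `le_bayesFactor`, for `p / n → q`,
where `t` is the squared sine of the cut-off angle. -/
def bayesRate (q β t : ℝ) : ℝ :=
  q * Real.log (q * t) + (1 - q) * Real.log (1 + q * t) - Real.log (β + q)

/-- After `N` is factored out of each logarithm, the `log N` terms cancel, since the weights `a + b`
and `-(a + b)` sum to zero. -/
lemma tendsto_exponent_div {N P a b : ℕ → ℝ} {q β t : ℝ} (hN : Tendsto N atTop atTop)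
    (hP : Tendsto (fun k => P k / N k) atTop (𝓝 q)) (ha : Tendsto (fun k => a k / N k) atTop (𝓝 q))
    (hb : Tendsto (fun k => b k / N k) atTop (𝓝 (1 - q))) (hq : 0 < q) (hβ : 0 < β) (ht : 0 < t) :
    Tendsto (fun k => (a k * Real.log (P k * t) + b k * Real.log (N k + P k * t) -
      (a k + b k) * Real.log (N k * β + P k)) / N k) atTop (𝓝 (bayesRate q β t)) := by
  have h1 : Tendsto (fun k => Real.log (P k / N k * t)) atTop (𝓝 (Real.log (q * t))) :=
    (hP.mul_const t).log (by positivity)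
  have h2 : Tendsto (fun k => Real.log (1 + P k / N k * t)) atTop (𝓝 (Real.log (1 + q * t))) :=
    ((hP.mul_const t).const_add 1).log (by positivity)
  have h3 : Tendsto (fun k => Real.log (β + P k / N k)) atTop (𝓝 (Real.log (β + q))) :=
    (hP.const_add β).log (by positivity)
  have h := ((ha.mul h1).add (hb.mul h2)).sub ((ha.add hb).mul h3)
  rw [add_sub_cancel, one_mul] at h
  refine h.congr' ?_
  filter_upwards [hN.eventually_gt_atTop 0, hP.eventually (lt_mem_nhds hq)] with k hNk hPk
  have hPk' : 0 < P k := by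
    have := mul_pos hPk hNk
    rwa [div_mul_cancel₀ _ hNk.ne'] at this
  have e1 : P k * t = N k * (P k / N k * t) := by field_simp
  have e2 : N k + P k * t = N k * (1 + P k / N k * t) := by field_simp
  have e3 : N k * β + P k = N k * (β + P k / N k) := by field_simp
  rw [e2, e3, e1, Real.log_mul hNk.ne' (by positivity), Real.log_mul hNk.ne' (by positivity),
    Real.log_mul hNk.ne' (by positivity)]
  field_simp
  ring

lemma bayesRate_one {r β : ℝ} (hr : 1 < r) :
    bayesRate (1 / r) β 1 = Real.log (1 / r * thresholdPow r) - Real.log (β + 1 / r) := by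
  have hr0 : 0 < r := by linarith
  have h1 : 1 + 1 / r = 1 / r * (r + 1) := by field_simp
  rw [bayesRate, mul_one, h1, Real.log_mul (by positivity) (by positivity),
    Real.log_mul (by positivity) (thresholdPow_pos hr0).ne', thresholdPow,
    Real.log_rpow (by linarith)]
  field_simp
  ring

/-- Translates the threshold on `δ` into the critical level for the limiting ratio of residual sums
of squares. -/
lemma lt_deltaBound_iff {r δ : ℝ} (hr : 1 < r) (hδ : 0 ≤ δ) :
    δ < deltaBound r ↔ 1 / r * (thresholdPow r - 1) < (1 - 1 / r) / (1 + δ) := by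
  have hr0 : 0 < r := by linarith
  have hT : 0 < thresholdPow r - 1 := sub_pos.2 (one_lt_thresholdPow hr)
  have h1 : 1 / r * (thresholdPow r - 1) = (thresholdPow r - 1) / r := by ring
  have h2 : (1 - 1 / r) / (1 + δ) = (r - 1) / ((1 + δ) * r) := by field_simp
  rw [h1, h2, ← div_div, div_lt_div_iff_of_pos_right hr0, lt_div_iff₀ (by linarith), deltaBound,
    lt_sub_iff_add_lt, lt_div_iff₀ (by exact hT), thresholdPow]
  constructor <;> intro h <;> linarith

lemma deltaBound_lt_iff {r δ : ℝ} (hr : 1 < r) (hδ : 0 ≤ δ) :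
    deltaBound r < δ ↔ (1 - 1 / r) / (1 + δ) < 1 / r * (thresholdPow r - 1) := by
  have hr0 : 0 < r := by linarith
  have hT : 0 < thresholdPow r - 1 := sub_pos.2 (one_lt_thresholdPow hr)
  have h1 : 1 / r * (thresholdPow r - 1) = (thresholdPow r - 1) / r := by ring
  have h2 : (1 - 1 / r) / (1 + δ) = (r - 1) / ((1 + δ) * r) := by field_simp
  rw [h1, h2, ← div_div, div_lt_div_iff_of_pos_right hr0, div_lt_iff₀ (by linarith), deltaBound,
    sub_lt_iff_lt_add, div_lt_iff₀ (by exact hT), thresholdPow]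
  constructor <;> intro h <;> linarith

/-- Bernoulli gives `1 + r ≤ 2 ^ r`. The bound places the critical level at or above `(1 - 1/r)/2`,
beyond which the integrand peaks at `t = 1` in the limit. -/
lemma half_le_thresholdPow {r : ℝ} (hr : 1 < r) : (r + 1) / 2 ≤ thresholdPow r := by
  have hr0 : 0 < r := by linarith
  have h1 : 1 + r * 1 ≤ (1 + 1 : ℝ) ^ r := one_add_mul_self_le_rpow_one_add (by norm_num) hr.le
  have h2 : (r + 1) ^ (1 / r) ≤ 2 := by
    calc (r + 1) ^ (1 / r) ≤ ((2 : ℝ) ^ r) ^ (1 / r) :=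
          Real.rpow_le_rpow (by linarith) (by norm_num at h1; linarith) (by positivity)
      _ = 2 := by rw [← Real.rpow_mul (by norm_num), mul_one_div_cancel hr0.ne', Real.rpow_one]
  have h3 : thresholdPow r = (r + 1) / (r + 1) ^ (1 / r) := by
    rw [thresholdPow, sub_div, div_self hr0.ne', Real.rpow_sub (by linarith), Real.rpow_one]
  rw [h3]
  exact div_le_div_of_nonneg_left (by linarith) (Real.rpow_pos_of_pos (by linarith) _) h2

section Sequences

variable {n p i : ℕ → ℕ} {r : ℝ}

lemma eventually_forall_abs_bayesFactor_lt (X : ∀ k, Matrix (Fin (n k)) (Fin (p k)) ℝ)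
    (e : ∀ k, Fin (i k) ↪ Fin (p k)) (hn : Tendsto n atTop atTop) (hip : ∀ k, i k ≤ p k)
    (hpn : ∀ k, p k ≤ n k) (hp : Tendsto (fun k => (p k : ℝ) / n k) atTop (𝓝 (1 / r)))
    (hi : Tendsto (fun k => (i k : ℝ) / n k) atTop (𝓝 0)) (hr : 1 < r) {β₀ : ℝ}
    (hβ₀ : 1 / r * (thresholdPow r - 1) < β₀) {ε : ℝ} (hε : 0 < ε) :
    ∀ᶠ k in atTop, ∀ y, β₀ ≤ rssRatio (X k) (e k) y → |bayesFactor (X k) (e k) y| < ε := by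
  have hr0 : 0 < r := by linarith
  have hq : 0 < 1 / r := by positivity
  have hβ₀' : 0 < β₀ := lt_trans (mul_pos hq (sub_pos.2 (one_lt_thresholdPow hr))) hβ₀
  have hN : Tendsto (fun k => (n k : ℝ)) atTop atTop := tendsto_natCast_atTop_atTop.comp hn
  have hP : Tendsto (fun k => ((p k : ℝ) + 1) / n k) atTop (𝓝 (1 / r)) := by
    simpa [add_div] using hp.add hN.inv_tendsto_atTop
  have ha : Tendsto (fun k => ((p k : ℝ) - i k) / n k) atTop (𝓝 (1 / r)) := by
    simpa [sub_div] using hp.sub hi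
  have hb : Tendsto (fun k => ((n k : ℝ) - p k) / n k) atTop (𝓝 (1 - 1 / r)) := by
    refine (hp.const_sub 1).congr' ?_
    filter_upwards [hN.eventually_gt_atTop 0] with k hk
    rw [sub_div, div_self hk.ne']
  have hmono : ∀ᶠ k in atTop, 0 ≤ ((p k : ℝ) - i k) * β₀ * (n k + (p k + 1)) +
      ((n k : ℝ) - p k) * (β₀ - 1) * (p k + 1) := by
    have hlim := ((ha.mul_const β₀).mul (hP.const_add 1)).add ((hb.mul_const (β₀ - 1)).mul hP)
    have hpos : 0 < 1 / r * β₀ * (1 + 1 / r) + (1 - 1 / r) * (β₀ - 1) * (1 / r) := by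
      have h1 := half_le_thresholdPow hr
      have h2 : 1 / r * ((r + 1) / 2 - 1) < β₀ :=
        lt_of_le_of_lt (mul_le_mul_of_nonneg_left (by linarith) hq.le) hβ₀
      have h3 : 1 / r * ((r + 1) / 2 - 1) = (1 - 1 / r) / 2 := by field_simp; ring
      have h4 : 1 / r * β₀ * (1 + 1 / r) + (1 - 1 / r) * (β₀ - 1) * (1 / r) =
        1 / r * (2 * β₀ - (1 - 1 / r)) := by ring
      rw [h4]
      exact mul_pos hq (by linarith)
    filter_upwards [hlim.eventually (lt_mem_nhds hpos), hN.eventually_gt_atTop 0] with k hk hk0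
    have h5 : ((p k : ℝ) - i k) * β₀ * (n k + (p k + 1)) +
        ((n k : ℝ) - p k) * (β₀ - 1) * (p k + 1) =
        (((p k : ℝ) - i k) / n k * β₀ * (1 + ((p k : ℝ) + 1) / n k) +
          ((n k : ℝ) - p k) / n k * (β₀ - 1) * (((p k : ℝ) + 1) / n k)) * (n k) ^ 2 := by
      field_simp
    rw [h5]
    exact mul_nonneg hk.le (by positivity)
  have hrate : bayesRate (1 / r) β₀ 1 < 0 := by
    rw [bayesRate_one hr, sub_neg]
    refine Real.log_lt_log (mul_pos hq (thresholdPow_pos hr0)) ?_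
    linarith
  have hlim := tendsto_exponent_div hN hP ha hb hq hβ₀' one_pos
  have hexp := Real.tendsto_exp_atBot.comp ((hN.atTop_mul_neg hrate hlim).atBot_div_const two_pos)
  filter_upwards [hexp.eventually (gt_mem_nhds hε), hmono, hN.eventually_gt_atTop 0]
    with k hk hm hk0 y hy
  refine lt_of_le_of_lt (abs_bayesFactor_le (X k) (e k) y (by exact_mod_cast hk0) (hip k) (hpn k)
    hβ₀' hy hm) (lt_of_eq_of_lt ?_ hk)
  rw [Function.comp_apply, mul_div_cancel₀ _ hk0.ne', mul_one]

lemma eventually_forall_lt_bayesFactor (X : ∀ k, Matrix (Fin (n k)) (Fin (p k)) ℝ)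
    (e : ∀ k, Fin (i k) ↪ Fin (p k)) (hn : Tendsto n atTop atTop) (hip : ∀ k, i k ≤ p k)
    (hpn : ∀ k, p k ≤ n k) (hp : Tendsto (fun k => (p k : ℝ) / n k) atTop (𝓝 (1 / r)))
    (hi : Tendsto (fun k => (i k : ℝ) / n k) atTop (𝓝 0)) (hr : 1 < r) {β₁ : ℝ} (hβ₁0 : 0 < β₁)
    (hβ₁ : β₁ < 1 / r * (thresholdPow r - 1)) (K : ℝ) :
    ∀ᶠ k in atTop, ∀ y, 0 < rssRatio (X k) (e k) y → rssRatio (X k) (e k) y ≤ β₁ →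
      K < bayesFactor (X k) (e k) y := by
  have hr0 : 0 < r := by linarith
  have hq : 0 < 1 / r := by positivity
  have hN : Tendsto (fun k => (n k : ℝ)) atTop atTop := tendsto_natCast_atTop_atTop.comp hn
  have hP : Tendsto (fun k => ((p k : ℝ) + 1) / n k) atTop (𝓝 (1 / r)) := by
    simpa [add_div] using hp.add hN.inv_tendsto_atTop
  have ha : Tendsto (fun k => ((p k : ℝ) - i k) / n k) atTop (𝓝 (1 / r)) := by
    simpa [sub_div] using hp.sub hi
  have hb : Tendsto (fun k => ((n k : ℝ) - p k) / n k) atTop (𝓝 (1 - 1 / r)) := by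
    refine (hp.const_sub 1).congr' ?_
    filter_upwards [hN.eventually_gt_atTop 0] with k hk
    rw [sub_div, div_self hk.ne']
  have hrate1 : 0 < bayesRate (1 / r) β₁ 1 := by
    rw [bayesRate_one hr, sub_pos]
    refine Real.log_lt_log (by positivity) ?_
    linarith
  -- The rate is positive at `sin ψ = 1`, hence by continuity also for some `ψ` just below `π/2`.
  obtain ⟨ψ, hψ0, hψ, hrate⟩ : ∃ ψ, 0 < ψ ∧ ψ < Real.pi / 2 ∧
      0 < bayesRate (1 / r) β₁ (Real.sin ψ ^ 2) := by
    have hcont : ContinuousAt (fun ψ => bayesRate (1 / r) β₁ (Real.sin ψ ^ 2)) (Real.pi / 2) := by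
      unfold bayesRate
      refine ((ContinuousAt.mul continuousAt_const (ContinuousAt.log (by fun_prop) ?_)).add
        (ContinuousAt.mul continuousAt_const (ContinuousAt.log (by fun_prop) ?_))).sub
        continuousAt_const
      · simp [hr0.ne']
      · simp only [Real.sin_pi_div_two]; positivity
    have h1 : ∀ᶠ ψ in 𝓝[<] (Real.pi / 2), 0 < bayesRate (1 / r) β₁ (Real.sin ψ ^ 2) :=
      (hcont.eventually (lt_mem_nhds (by simpa using hrate1))).filter_mono nhdsWithin_le_nhds
    have h2 : ∀ᶠ ψ in 𝓝[<] (Real.pi / 2), 0 < ψ :=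
      (lt_mem_nhds (by positivity)).filter_mono nhdsWithin_le_nhds
    obtain ⟨ψ, h3, h4, h5⟩ := (h1.and (h2.and self_mem_nhdsWithin)).exists
    exact ⟨ψ, h4, h5, h3⟩
  have hsψ : 0 < Real.sin ψ := Real.sin_pos_of_pos_of_lt_pi hψ0 (by linarith [Real.pi_pos])
  have hlim := tendsto_exponent_div hN hP ha hb hq hβ₁0 (pow_pos hsψ 2)
  have hexp := (Real.tendsto_exp_atTop.comp ((hN.atTop_mul_pos hrate hlim).atTop_div_const
    two_pos)).const_mul_atTop
      (show 0 < 2 / Real.pi * (Real.pi / 2 - ψ) from mul_pos (by positivity) (by linarith))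
  filter_upwards [hexp.eventually_gt_atTop K, hN.eventually_gt_atTop 0] with k hk hk0 y hy0 hy
  refine lt_of_lt_of_le (lt_of_lt_of_eq hk ?_) (le_bayesFactor (X k) (e k) y
    (by exact_mod_cast hk0) (hip k) (hpn k) hy0 hy hψ0 hψ.le)
  rw [Function.comp_apply, mul_div_cancel₀ _ hk0.ne']

end Sequences

/-! ### Quadratic forms of Gaussian vectors -/

/-- The standard Gaussian law on `Fin n → ℝ` is invariant under orthogonal transformations. -/
lemma map_pi_gaussianReal_orthonormalBasis {n : ℕ}
    (b : OrthonormalBasis (Fin n) ℝ (EuclideanSpace ℝ (Fin n))) :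
    (Measure.pi fun _ : Fin n => gaussianReal 0 1).map (fun x j => ∑ l, x l * b l j) =
      Measure.pi fun _ : Fin n => gaussianReal 0 1 := by
  have h1 := stdGaussian_eq_map_pi_orthonormalBasis b
  rw [← map_pi_eq_stdGaussian] at h1
  have h2 := congrArg (fun μ => μ.map (WithLp.ofLp (p := 2) (V := Fin n → ℝ))) h1
  rw [Measure.map_map (by fun_prop) (by fun_prop), Measure.map_map (by fun_prop) (by fun_prop)] at h2
  have h3 : (WithLp.ofLp (p := 2) (V := Fin n → ℝ)) ∘ WithLp.toLp 2 = id := rfl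
  rw [h3, Measure.map_id] at h2
  refine Eq.trans ?_ h2.symm
  congr 1
  ext x j
  simp

lemma map_pi_gaussianReal_affine {n : ℕ} (m : Fin n → ℝ) (σ : ℝ) :
    (Measure.pi fun _ : Fin n => gaussianReal 0 1).map (fun x j => m j + σ * x j) =
      Measure.pi fun j => gaussianReal (m j) (Real.toNNReal (σ ^ 2)) := by
  rw [Measure.pi_map_pi (f := fun j x => m j + σ * x) (fun j => by fun_prop)]
  congr 1
  ext1 j
  have : (fun x => m j + σ * x) = (fun x => m j + x) ∘ (fun x => σ * x) := rfl
  rw [this, ← Measure.map_map (by fun_prop) (by fun_prop), gaussianReal_map_const_mul,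
    gaussianReal_map_const_add]
  congr 1
  · simp
  · ext; simp [Real.coe_toNNReal _ (sq_nonneg σ)]

lemma memLp_sq_affine_gaussianReal (c σ : ℝ) :
    MemLp (fun x : ℝ => (c + σ * x) ^ 2) 2 (gaussianReal 0 1) := by
  have h : MemLp (fun x : ℝ => c + σ * x) 4 (gaussianReal 0 1) :=
    (memLp_const c).add ((memLp_id_gaussianReal' 4 (by simp)).const_mul σ)
  rw [memLp_two_iff_integrable_sq (by fun_prop)]
  refine (h.integrable_norm_pow (p := 4) (by norm_num)).congr (.of_forall fun x => ?_)
  simp only [Real.norm_eq_abs]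
  rw [← pow_mul, Even.pow_abs (by decide)]

lemma integral_sq_affine_gaussianReal (c σ : ℝ) :
    ∫ x, (c + σ * x) ^ 2 ∂(gaussianReal 0 1) = c ^ 2 + σ ^ 2 := by
  have hid : MemLp (fun x : ℝ => σ * x) 2 (gaussianReal 0 1) :=
    (memLp_id_gaussianReal' 2 (by simp)).const_mul σ
  have hL : MemLp (fun x : ℝ => c + σ * x) 2 (gaussianReal 0 1) := (memLp_const c).add hid
  have hv := variance_eq_sub hL
  rw [variance_const_add (by fun_prop), variance_const_mul, variance_fun_id_gaussianReal,
    integral_add (integrable_const _) (hid.integrable (by norm_num)), integral_const_mul,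
    integral_id_gaussianReal] at hv
  simp at hv
  linarith

/-- The square of a Gaussian variable with mean `c` and variance `σ²` has variance at most a
universal multiple of `σ² (c² + σ²)`. -/
lemma exists_variance_sq_affine_le : ∃ C : ℝ, 0 ≤ C ∧ ∀ c σ : ℝ,
    Var[fun x : ℝ => (c + σ * x) ^ 2; gaussianReal 0 1] ≤ C * (σ ^ 2 * (c ^ 2 + σ ^ 2)) := by
  set V := Var[fun x : ℝ => x ^ 2; gaussianReal 0 1] with hV
  set κ := cov[fun x : ℝ => x, fun x : ℝ => x ^ 2; gaussianReal 0 1] with hκ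
  have hV0 : 0 ≤ V := variance_nonneg _ _
  -- The variance is `4 c² σ² + V σ⁴ + 4 c σ³ κ`, and the cross term is absorbed by `2 |cσ| ≤ c² +
  -- σ²`.
  refine ⟨4 + V + 2 * |κ|, by positivity, fun c σ => ?_⟩
  have hX : MemLp (fun x : ℝ => (2 * c * σ) * x) 2 (gaussianReal 0 1) :=
    (memLp_id_gaussianReal' 2 (by simp)).const_mul _
  have hY : MemLp (fun x : ℝ => σ ^ 2 * x ^ 2) 2 (gaussianReal 0 1) := by
    simpa using (memLp_sq_affine_gaussianReal 0 1).const_mul (σ ^ 2)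
  have hexp : (fun x : ℝ => (c + σ * x) ^ 2) =
      fun x => c ^ 2 + ((2 * c * σ) * x + σ ^ 2 * x ^ 2) := by
    ext x; ring
  rw [hexp, variance_const_add (by fun_prop), variance_fun_add hX hY, variance_const_mul,
    variance_const_mul, covariance_const_mul_left, covariance_const_mul_right,
    variance_fun_id_gaussianReal, ← hV, ← hκ]
  have h1 : c * σ ^ 3 * κ ≤ |κ| * (σ ^ 2 * (c ^ 2 + σ ^ 2)) / 2 := by
    have h2 : |c * σ| ≤ (c ^ 2 + σ ^ 2) / 2 := by
      rw [abs_mul]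
      nlinarith [sq_nonneg (|c| - |σ|), sq_abs c, sq_abs σ]
    calc c * σ ^ 3 * κ = σ ^ 2 * (c * σ * κ) := by ring
      _ ≤ σ ^ 2 * (|c * σ| * |κ|) := by
          rw [← abs_mul]; exact mul_le_mul_of_nonneg_left (le_abs_self _) (sq_nonneg σ)
      _ ≤ σ ^ 2 * ((c ^ 2 + σ ^ 2) / 2 * |κ|) := by gcongr
      _ = _ := by ring
  have h3 : 0 ≤ σ ^ 4 := by positivity
  have h4 : 0 ≤ V * (σ ^ 2 * c ^ 2) := by positivity
  simp only [NNReal.coe_one]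
  nlinarith

section QuadraticForm

variable {n : ℕ} {A : Matrix (Fin n) (Fin n) ℝ}

lemma eigenvalues_sq_of_idempotent (hA : A.IsHermitian) (hAA : A * A = A) (j : Fin n) :
    hA.eigenvalues j ^ 2 = hA.eigenvalues j := by
  have h1 := hA.mulVec_eigenvectorBasis j
  have h2 : A *ᵥ (A *ᵥ ⇑(hA.eigenvectorBasis j)) = A *ᵥ ⇑(hA.eigenvectorBasis j) := by
    rw [Matrix.mulVec_mulVec, hAA]
  rw [h1, Matrix.mulVec_smul, h1, smul_smul] at h2
  have hne : (⇑(hA.eigenvectorBasis j) : Fin n → ℝ) ≠ 0 := by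
    intro h
    exact hA.eigenvectorBasis.toBasis.ne_zero j (by ext l; simpa using congrFun h l)
  rw [sq]
  exact smul_left_injective ℝ hne h2

lemma dotProduct_mulVec_eq_sum_eigenvalues (hA : A.IsHermitian) (y : Fin n → ℝ) :
    y ⬝ᵥ (A *ᵥ y) =
      ∑ j, hA.eigenvalues j * (⇑(hA.eigenvectorBasis j) ⬝ᵥ y) ^ 2 := by
  have h := hA.eigenvectorBasis.sum_inner_mul_inner (WithLp.toLp 2 y) (WithLp.toLp 2 (A *ᵥ y))
  have hAt : Aᵀ = A := by
    rwa [Matrix.IsHermitian, Matrix.conjTranspose_eq_transpose_of_trivial] at hA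
  simp only [EuclideanSpace.inner_eq_star_dotProduct, star_trivial] at h
  rw [dotProduct_comm, ← h]
  refine Finset.sum_congr rfl fun j _ => ?_
  have h1 : (A *ᵥ y) ⬝ᵥ ⇑(hA.eigenvectorBasis j) =
      hA.eigenvalues j * (⇑(hA.eigenvectorBasis j) ⬝ᵥ y) := by
    rw [dotProduct_comm, Matrix.dotProduct_mulVec, ← Matrix.mulVec_transpose, hAt,
      hA.mulVec_eigenvectorBasis, smul_dotProduct, smul_eq_mul]
  rw [h1]
  ring

lemma eigenvectorBasis_dotProduct_sum (hA : A.IsHermitian) (x : Fin n → ℝ) (j : Fin n) :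
    (⇑(hA.eigenvectorBasis j) ⬝ᵥ fun l => ∑ k, x k * hA.eigenvectorBasis k l) = x j := by
  have h := hA.eigenvectorBasis.orthonormal.inner_right_fintype x j
  rw [EuclideanSpace.inner_eq_star_dotProduct, star_trivial, dotProduct_comm] at h
  have h1 : (fun l => ∑ k, x k * hA.eigenvectorBasis k l) =
      ⇑(∑ k, x k • hA.eigenvectorBasis k) := by
    ext l; simp
  rw [h1]
  exact h

/-- Chebyshev's inequality for the quadratic form of an orthogonal projection in a Gaussian
vector. -/
lemma exists_measure_quadForm_le : ∃ C : ℝ, 0 ≤ C ∧ ∀ {n : ℕ} {A : Matrix (Fin n) (Fin n) ℝ},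
    A.IsHermitian → A * A = A → ∀ (m : Fin n → ℝ) (σ : ℝ) {η : ℝ}, 0 < η →
    (Measure.pi fun j => gaussianReal (m j) (Real.toNNReal (σ ^ 2)))
      {y | η ≤ |y ⬝ᵥ (A *ᵥ y) - (m ⬝ᵥ (A *ᵥ m) + σ ^ 2 * A.trace)|} ≤
      ENNReal.ofReal (C * (σ ^ 2 * (m ⬝ᵥ (A *ᵥ m) + σ ^ 2 * A.trace)) / η ^ 2) := by
  obtain ⟨C, hC0, hC⟩ := exists_variance_sq_affine_le
  refine ⟨C, hC0, fun {n A} hA hAA m σ η hη => ?_⟩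
  set l := hA.eigenvalues with hl
  set c : Fin n → ℝ := fun j => ⇑(hA.eigenvectorBasis j) ⬝ᵥ m with hc
  set ν : Measure (Fin n → ℝ) := Measure.pi fun _ => gaussianReal 0 1 with hν
  -- The noise is expressed in the eigenbasis of `A`, so the `j`-th coordinate of `T x` is `c j + σ
  -- * x j` and the coordinates are independent.
  set T : (Fin n → ℝ) → Fin n → ℝ :=
    fun x k => m k + σ * ∑ j, x j * hA.eigenvectorBasis j k with hT
  set Q : Fin n → ℝ → ℝ := fun j x => l j * (c j + σ * x) ^ 2 with hQ
  have hTmeas : Measurable T := by fun_prop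
  have hmap : Measure.pi (fun j => gaussianReal (m j) (Real.toNNReal (σ ^ 2))) = ν.map T := by
    rw [← map_pi_gaussianReal_affine m σ,
      ← map_pi_gaussianReal_orthonormalBasis hA.eigenvectorBasis,
      Measure.map_map (by fun_prop) (by fun_prop)]
    rfl
  have hform : ∀ x, T x ⬝ᵥ (A *ᵥ T x) = (∑ j, fun x : Fin n → ℝ => Q j (x j)) x := by
    intro x
    rw [dotProduct_mulVec_eq_sum_eigenvalues hA, Finset.sum_apply]
    refine Finset.sum_congr rfl fun j _ => ?_
    have : T x = m + σ • fun k => ∑ j, x j * hA.eigenvectorBasis j k := rfl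
    rw [this, dotProduct_add, dotProduct_smul, eigenvectorBasis_dotProduct_sum, smul_eq_mul]
  have hmem : ∀ j, MemLp (Q j) 2 (gaussianReal 0 1) := fun j =>
    (memLp_sq_affine_gaussianReal (c j) σ).const_mul (l j)
  have hmem' : ∀ j, MemLp (fun x : Fin n → ℝ => Q j (x j)) 2 ν := fun j =>
    (hmem j).comp_measurePreserving (measurePreserving_eval _ j)
  have hmm : m ⬝ᵥ (A *ᵥ m) + σ ^ 2 * A.trace = ∑ j, l j * (c j ^ 2 + σ ^ 2) := by
    rw [dotProduct_mulVec_eq_sum_eigenvalues hA, hA.trace_eq_sum_eigenvalues, Finset.mul_sum,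
      ← Finset.sum_add_distrib]
    refine Finset.sum_congr rfl fun j _ => ?_
    simp only [hl, hc, RCLike.ofReal_real_eq_id, id]
    ring
  have hmean : ν[∑ j, fun x : Fin n → ℝ => Q j (x j)] = m ⬝ᵥ (A *ᵥ m) + σ ^ 2 * A.trace := by
    have h1 : (∑ j, fun x : Fin n → ℝ => Q j (x j)) = fun x => ∑ j, Q j (x j) := by
      ext x; simp
    rw [h1, integral_finsetSum _ fun j _ => (hmem' j).integrable (by norm_num), hmm]
    refine Finset.sum_congr rfl fun j _ => ?_
    rw [integral_comp_eval (hmem j).aestronglyMeasurable, integral_const_mul,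
      integral_sq_affine_gaussianReal]
  -- Idempotence makes the squared eigenvalues in the variance equal to the eigenvalues, so the
  -- variance is controlled by the mean.
  have hvar : Var[∑ j, fun x : Fin n → ℝ => Q j (x j); ν] ≤
      C * (σ ^ 2 * (m ⬝ᵥ (A *ᵥ m) + σ ^ 2 * A.trace)) := by
    rw [variance_sum_pi hmem, hmm, Finset.mul_sum, Finset.mul_sum]
    refine Finset.sum_le_sum fun j _ => ?_
    rw [variance_const_mul, eigenvalues_sq_of_idempotent hA hAA]
    have hl0 : 0 ≤ l j := by
      rw [hl, ← eigenvalues_sq_of_idempotent hA hAA]; positivity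
    refine (mul_le_mul_of_nonneg_left (hC (c j) σ) hl0).trans_eq ?_
    ring
  have hcheb := meas_ge_le_variance_div_sq (memLp_finsetSum' Finset.univ fun j _ => hmem' j) hη
  rw [hmean] at hcheb
  rw [hmap, Measure.map_apply hTmeas]
  · refine le_trans (le_of_eq ?_) (hcheb.trans (ENNReal.ofReal_le_ofReal (by gcongr)))
    congr 1
    ext x
    simp only [Set.mem_preimage, Set.mem_ofPred_eq, hform]
  · refine measurableSet_le measurable_const ?_
    simp only [dotProduct, Matrix.mulVec]
    fun_prop

end QuadraticForm

/-- The law of large numbers for the quadratic forms of projections in Gaussian vectors. -/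
lemma tendstoInProb_quadForm {n : ℕ → ℕ} (hn : Tendsto n atTop atTop)
    (A : ∀ k, Matrix (Fin (n k)) (Fin (n k)) ℝ) (hA : ∀ k, (A k).IsHermitian)
    (hAA : ∀ k, A k * A k = A k) (m : ∀ k, Fin (n k) → ℝ) (σ : ℕ → ℝ) (hσ : ∀ k, 0 < σ k) {d : ℝ}
    (hd : Tendsto (fun k => m k ⬝ᵥ (A k *ᵥ m k) / (n k * σ k ^ 2) + (A k).trace / n k) atTop (𝓝 d)) :
    TendstoInProb (fun k => Measure.pi fun j => gaussianReal (m k j) (Real.toNNReal (σ k ^ 2)))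
      (fun k y => y ⬝ᵥ (A k *ᵥ y) / (n k * σ k ^ 2)) d := by
  obtain ⟨C, hC0, hC⟩ := exists_measure_quadForm_le
  intro ε hε
  have hN : Tendsto (fun k => (n k : ℝ)) atTop atTop := tendsto_natCast_atTop_atTop.comp hn
  set D := fun k => m k ⬝ᵥ (A k *ᵥ m k) / (n k * σ k ^ 2) + (A k).trace / n k with hD
  have hlim : Tendsto (fun k => ENNReal.ofReal (C * D k / (ε / 2) ^ 2 * (n k : ℝ)⁻¹)) atTop (𝓝 0) := by
    have := ((hd.const_mul C).div_const ((ε / 2) ^ 2)).mul hN.inv_tendsto_atTop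
    rw [mul_zero] at this
    simpa using ENNReal.tendsto_ofReal this
  refine tendsto_of_tendsto_of_tendsto_of_le_of_le' tendsto_const_nhds hlim
    (.of_forall fun _ => zero_le) ?_
  filter_upwards [Metric.tendsto_nhds.1 hd (ε / 2) (by linarith), hN.eventually_gt_atTop 0]
    with k hk hk0
  have hσk := (hσ k).ne'
  have hs : 0 < σ k ^ 2 := pow_pos (hσ k) 2
  have hns : 0 < n k * σ k ^ 2 := mul_pos hk0 hs
  have hDk : m k ⬝ᵥ (A k *ᵥ m k) + σ k ^ 2 * (A k).trace = D k * (n k * σ k ^ 2) := by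
    simp only [hD]; field_simp
  -- Half of `ε` covers the distance from `D k` to `d`, the other half the random fluctuation.
  have h := hC (hA k) (hAA k) (m k) (σ k) (η := ε / 2 * (n k * σ k ^ 2)) (by positivity)
  rw [hDk] at h
  refine (measure_mono fun y hy => ?_).trans (h.trans_eq (congrArg _ ?_))
  · simp only [Set.mem_ofPred_eq] at hy ⊢
    rw [Real.dist_eq] at hk
    have h1 : |y ⬝ᵥ (A k *ᵥ y) / (n k * σ k ^ 2) - D k| ≥ ε / 2 := by
      have := abs_sub_le (y ⬝ᵥ (A k *ᵥ y) / (n k * σ k ^ 2)) (D k) d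
      linarith
    have h2 : y ⬝ᵥ (A k *ᵥ y) - D k * (n k * σ k ^ 2) =
        (y ⬝ᵥ (A k *ᵥ y) / (n k * σ k ^ 2) - D k) * (n k * σ k ^ 2) := by
      field_simp
    rw [h2, abs_mul, abs_of_pos hns]
    exact mul_le_mul_of_nonneg_right h1 hns.le
  · field_simp

lemma TendstoInProb.div {n : ℕ → ℕ} {P : ∀ k, Measure (Fin (n k) → ℝ)}
    {U V : ∀ k, (Fin (n k) → ℝ) → ℝ} {u v : ℝ} (hU : TendstoInProb P U u)
    (hV : TendstoInProb P V v) (hv : v ≠ 0) :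
    TendstoInProb P (fun k y => U k y / V k y) (u / v) := by
  intro ε hε
  have hcont : ContinuousAt (fun z : ℝ × ℝ => z.1 / z.2) (u, v) :=
    continuousAt_fst.div continuousAt_snd hv
  obtain ⟨η, hη, h⟩ := Metric.continuousAt_iff.1 hcont ε hε
  have hlim := (hU η hη).add (hV η hη)
  rw [add_zero] at hlim
  refine tendsto_of_tendsto_of_tendsto_of_le_of_le tendsto_const_nhds hlim
    (fun _ => zero_le) fun k => (measure_mono fun y hy => ?_).trans (measure_union_le _ _)
  by_contra hc
  simp only [Set.mem_union, Set.mem_ofPred_eq, not_or, not_le] at hc hy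
  have := h (x := (U k y, V k y)) (by
    rw [Prod.dist_eq]; exact max_lt hc.1 hc.2)
  rw [Real.dist_eq] at this
  linarith

lemma TendstoInProb.congr {n : ℕ → ℕ} {P : ∀ k, Measure (Fin (n k) → ℝ)}
    {U V : ∀ k, (Fin (n k) → ℝ) → ℝ} {u : ℝ} (hU : TendstoInProb P U u)
    (h : ∀ᶠ k in atTop, U k = V k) : TendstoInProb P V u := by
  intro ε hε
  refine (hU ε hε).congr' ?_
  filter_upwards [h] with k hk
  rw [hk]

/-! ### The residual sums of squares -/

section HatMatrix

variable {n p i : ℕ} {X : Matrix (Fin n) (Fin p) ℝ}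

lemma isUnit_det_gram (hX : LinearIndependent ℝ X.col) : IsUnit (Xᵀ * X).det := by
  have := Matrix.PosDef.conjTranspose_mul_self X (Matrix.mulVec_injective_iff.2 hX)
  rw [Matrix.conjTranspose_eq_transpose_of_trivial] at this
  exact this.det_pos.ne'.isUnit

lemma hatMatrix_mul_self_design (hX : LinearIndependent ℝ X.col) : hatMatrix X * X = X := by
  rw [hatMatrix, Matrix.mul_assoc, Matrix.mul_assoc, Matrix.nonsing_inv_mul _ (isUnit_det_gram hX),
    Matrix.mul_one]

lemma transpose_hatMatrix (X : Matrix (Fin n) (Fin p) ℝ) : (hatMatrix X)ᵀ = hatMatrix X := by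
  simp [hatMatrix, Matrix.transpose_mul, Matrix.transpose_nonsing_inv, Matrix.mul_assoc]

lemma hatMatrix_mul_hatMatrix (hX : LinearIndependent ℝ X.col) :
    hatMatrix X * hatMatrix X = hatMatrix X := by
  conv_lhs => rw [hatMatrix.eq_def X, ← Matrix.mul_assoc, ← Matrix.mul_assoc,
    ← hatMatrix.eq_def X, hatMatrix_mul_self_design hX]
  rfl

lemma trace_hatMatrix (hX : LinearIndependent ℝ X.col) : (hatMatrix X).trace = p := by
  rw [hatMatrix, Matrix.mul_assoc, Matrix.trace_mul_comm, Matrix.mul_assoc,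
    Matrix.nonsing_inv_mul _ (isUnit_det_gram hX), Matrix.trace_one, Fintype.card_fin]

lemma isHermitian_one_sub_hatMatrix (X : Matrix (Fin n) (Fin p) ℝ) :
    (1 - hatMatrix X).IsHermitian := by
  rw [Matrix.IsHermitian, Matrix.conjTranspose_eq_transpose_of_trivial, Matrix.transpose_sub,
    transpose_hatMatrix, Matrix.transpose_one]

lemma one_sub_hatMatrix_idempotent (hX : LinearIndependent ℝ X.col) :
    (1 - hatMatrix X) * (1 - hatMatrix X) = 1 - hatMatrix X := by
  rw [sub_mul, mul_sub, mul_sub, hatMatrix_mul_hatMatrix hX]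
  simp

lemma trace_one_sub_hatMatrix (hX : LinearIndependent ℝ X.col) :
    (1 - hatMatrix X).trace = n - p := by
  rw [Matrix.trace_sub, trace_hatMatrix hX, Matrix.trace_one, Fintype.card_fin]

lemma one_sub_hatMatrix_mulVec_mulVec (hX : LinearIndependent ℝ X.col) (b : Fin p → ℝ) :
    (1 - hatMatrix X) *ᵥ (X *ᵥ b) = 0 := by
  rw [Matrix.mulVec_mulVec, Matrix.sub_mul, hatMatrix_mul_self_design hX, Matrix.one_mul, sub_self,
    Matrix.zero_mulVec]

lemma linearIndependent_subDesign (hX : LinearIndependent ℝ X.col) (e : Fin i ↪ Fin p) :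
    LinearIndependent ℝ (subDesign X e).col :=
  hX.comp e e.injective

lemma modelDistance_eq (X : Matrix (Fin n) (Fin p) ℝ) (e : Fin i ↪ Fin p) (β : Fin p → ℝ) (σ : ℝ) :
    modelDistance X e β σ =
      (X *ᵥ β) ⬝ᵥ ((1 - hatMatrix (subDesign X e)) *ᵥ (X *ᵥ β)) / (n * σ ^ 2) := by
  rw [modelDistance, Matrix.smul_mulVec, dotProduct_smul, smul_eq_mul, ← Matrix.mulVec_mulVec,
    ← Matrix.mulVec_mulVec, Matrix.dotProduct_mulVec _ Xᵀ, Matrix.vecMul_transpose]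
  ring

lemma modelDistance_nonneg (hX : LinearIndependent ℝ X.col) (e : Fin i ↪ Fin p) (β : Fin p → ℝ)
    (σ : ℝ) : 0 ≤ modelDistance X e β σ := by
  have hA := isHermitian_one_sub_hatMatrix (subDesign X e)
  rw [modelDistance_eq, dotProduct_mulVec_eq_sum_eigenvalues hA]
  refine div_nonneg (Finset.sum_nonneg fun j _ => ?_) (by positivity)
  rw [← eigenvalues_sq_of_idempotent hA
    (one_sub_hatMatrix_idempotent (linearIndependent_subDesign hX e))]
  positivity

/-- A mean vector of the reduced model is one of the full model. -/
lemma exists_mulVec_eq_subDesign_mulVec (X : Matrix (Fin n) (Fin p) ℝ) (e : Fin i ↪ Fin p)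
    (α : Fin i → ℝ) : ∃ β : Fin p → ℝ, X *ᵥ β = subDesign X e *ᵥ α := by
  refine ⟨fun j => ∑ l, if e l = j then α l else 0, ?_⟩
  ext k
  simp only [Matrix.mulVec, dotProduct, Finset.mul_sum, subDesign, Matrix.submatrix_apply, id]
  rw [Finset.sum_comm]
  simp

end HatMatrix

/-! ### Convergence in probability of the ratio and of the Bayes factor -/

section Sequences

variable {n p i : ℕ → ℕ} {r : ℝ} {X : ∀ k, Matrix (Fin (n k)) (Fin (p k)) ℝ}
  {e : ∀ k, Fin (i k) ↪ Fin (p k)}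

/-- Under the full model, the ratio of the residual sums of squares converges in probability. -/
lemma tendstoInProb_rssRatio (hn : Tendsto n atTop atTop)
    (hX : ∀ k, LinearIndependent ℝ (X k).col)
    (hp : Tendsto (fun k => (p k : ℝ) / n k) atTop (𝓝 (1 / r)))
    (hi : Tendsto (fun k => (i k : ℝ) / n k) atTop (𝓝 0))
    {β : ∀ k, Fin (p k) → ℝ} {σ : ℕ → ℝ} {δ : ℝ} (hσ : ∀ k, 0 < σ k)
    (hδ : Tendsto (fun k => modelDistance (X k) (e k) (β k) (σ k)) atTop (𝓝 δ)) (hδ0 : 0 ≤ δ) :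
    TendstoInProb (fun k => samplingLaw (X k) (β k) (σ k)) (fun k => rssRatio (X k) (e k))
      ((1 - 1 / r) / (1 + δ)) := by
  have hN : Tendsto (fun k => (n k : ℝ)) atTop atTop := tendsto_natCast_atTop_atTop.comp hn
  have hX' := fun k => linearIndependent_subDesign (hX k) (e k)
  -- The full projection kills the mean, so only the noise contributes, through the trace `n - p`.
  have hfull := tendstoInProb_quadForm hn (fun k => 1 - hatMatrix (X k))
    (fun k => isHermitian_one_sub_hatMatrix _) (fun k => one_sub_hatMatrix_idempotent (hX k))
    (fun k => X k *ᵥ β k) σ hσ (d := 1 - 1 / r) (by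
      refine (hp.const_sub 1).congr' ?_
      filter_upwards [hN.eventually_gt_atTop 0] with k hk
      rw [one_sub_hatMatrix_mulVec_mulVec (hX k), dotProduct_zero, zero_div, zero_add,
        trace_one_sub_hatMatrix (hX k), sub_div, div_self hk.ne'])
  -- Here the mean contributes exactly the model distance, and the trace gives `(n - i)/n → 1`.
  have hred := tendstoInProb_quadForm hn (fun k => 1 - hatMatrix (subDesign (X k) (e k)))
    (fun k => isHermitian_one_sub_hatMatrix _) (fun k => one_sub_hatMatrix_idempotent (hX' k))
    (fun k => X k *ᵥ β k) σ hσ (d := 1 + δ) (by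
      have h := hδ.add (hi.const_sub 1)
      rw [sub_zero, add_comm] at h
      refine h.congr' ?_
      filter_upwards [hN.eventually_gt_atTop 0] with k hk
      rw [modelDistance_eq, trace_one_sub_hatMatrix (hX' k), sub_div _ _ (n k : ℝ),
        div_self hk.ne'])
  refine (hfull.div hred (by linarith)).congr ?_
  filter_upwards [hN.eventually_gt_atTop 0] with k hk
  ext y
  have : (n k : ℝ) * σ k ^ 2 ≠ 0 := (mul_pos hk (pow_pos (hσ k) 2)).ne'
  rw [div_div_div_cancel_right₀ this, rssRatio, rss, rss]

lemma tendstoInProb_bayesFactor_zero (hn : Tendsto n atTop atTop)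
    (hX : ∀ k, LinearIndependent ℝ (X k).col) (hip : ∀ k, i k ≤ p k) (hpn : ∀ k, p k ≤ n k)
    (hp : Tendsto (fun k => (p k : ℝ) / n k) atTop (𝓝 (1 / r)))
    (hi : Tendsto (fun k => (i k : ℝ) / n k) atTop (𝓝 0)) (hr : 1 < r)
    {β : ∀ k, Fin (p k) → ℝ} {σ : ℕ → ℝ} {δ : ℝ} (hσ : ∀ k, 0 < σ k)
    (hδ : Tendsto (fun k => modelDistance (X k) (e k) (β k) (σ k)) atTop (𝓝 δ)) (hδ0 : 0 ≤ δ)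
    (hlt : δ < deltaBound r) :
    TendstoInProb (fun k => samplingLaw (X k) (β k) (σ k)) (fun k => bayesFactor (X k) (e k)) 0 := by
  intro ε hε
  -- With `β₀` strictly between the critical level and the limit of the ratio, the bad event forces
  -- the ratio away from its limit.
  obtain ⟨β₀, h1, h2⟩ := exists_between ((lt_deltaBound_iff hr hδ0).1 hlt)
  refine tendsto_of_tendsto_of_tendsto_of_le_of_le' tendsto_const_nhds
    (tendstoInProb_rssRatio hn hX hp hi hσ hδ hδ0 _ (sub_pos.2 h2)) (.of_forall fun _ => zero_le) ?_
  filter_upwards [eventually_forall_abs_bayesFactor_lt X e hn hip hpn hp hi hr h1 hε] with k hk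
  refine measure_mono fun y hy => ?_
  simp only [Set.mem_ofPred_eq, sub_zero] at hy ⊢
  by_contra! hc
  have := hk y (by linarith [(abs_lt.1 hc).1])
  linarith

lemma tendstoInProbAtTop_bayesFactor (hn : Tendsto n atTop atTop)
    (hX : ∀ k, LinearIndependent ℝ (X k).col) (hip : ∀ k, i k ≤ p k) (hpn : ∀ k, p k ≤ n k)
    (hp : Tendsto (fun k => (p k : ℝ) / n k) atTop (𝓝 (1 / r)))
    (hi : Tendsto (fun k => (i k : ℝ) / n k) atTop (𝓝 0)) (hr : 1 < r)
    {β : ∀ k, Fin (p k) → ℝ} {σ : ℕ → ℝ} {δ : ℝ} (hσ : ∀ k, 0 < σ k)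
    (hδ : Tendsto (fun k => modelDistance (X k) (e k) (β k) (σ k)) atTop (𝓝 δ)) (hδ0 : 0 ≤ δ)
    (hlt : deltaBound r < δ) :
    TendstoInProbAtTop (fun k => samplingLaw (X k) (β k) (σ k))
      (fun k => bayesFactor (X k) (e k)) := by
  intro K
  obtain ⟨β₁, h1, h2⟩ := exists_between ((deltaBound_lt_iff hr hδ0).1 hlt)
  have hr0 : 0 < r := by linarith
  have hlim0 : 0 < (1 - 1 / r) / (1 + δ) :=
    div_pos (sub_pos.2 ((div_lt_one hr0).2 hr)) (by linarith)
  refine tendsto_of_tendsto_of_tendsto_of_le_of_le' tendsto_const_nhds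
    -- The minimum keeps the ratio both positive and below `β₁`.
    (tendstoInProb_rssRatio hn hX hp hi hσ hδ hδ0 _ (lt_min hlim0 (sub_pos.2 h1)))
    (.of_forall fun _ => zero_le) ?_
  filter_upwards [eventually_forall_lt_bayesFactor X e hn hip hpn hp hi hr (hlim0.trans h1) h2 K]
    with k hk
  refine measure_mono fun y hy => ?_
  simp only [Set.mem_ofPred_eq] at hy ⊢
  by_contra! hc
  obtain ⟨h3, h4⟩ := lt_min_iff.1 hc
  have := hk y (by linarith [(abs_lt.1 h3).1]) (by linarith [(abs_lt.1 h4).2])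
  linarith

end Sequences

end IntrinsicBF

end

theorem theorem2 :
    -- a sequence of nested pairs of normal linear models, with sample sizes `n k → ∞`
    (∀ (n p i : ℕ → ℕ)
      (X : ∀ k, Matrix (Fin (n k)) (Fin (p k)) ℝ)
      (e : ∀ k, Fin (i k) ↪ Fin (p k))
      (a r : ℝ),
      Tendsto n atTop atTop →
      (∀ k, LinearIndependent ℝ (X k).col) →
      0 ≤ a → a < 1 →
      (fun k => (i k : ℝ)) =O[atTop] (fun k => (n k : ℝ) ^ a) →
      (fun k => (p k : ℝ)) =O[atTop] (fun k => (n k : ℝ)) →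
      Tendsto (fun k => (n k : ℝ) / (p k : ℝ)) atTop (𝓝 r) →
      1 < r →
      -- sampling from the reduced model
      (∀ (α : ∀ k, Fin (i k) → ℝ) (σ : ℕ → ℝ), (∀ k, 0 < σ k) →
        IntrinsicBF.TendstoInProb
          (fun k => IntrinsicBF.samplingLaw (IntrinsicBF.subDesign (X k) (e k)) (α k) (σ k))
          (fun k => IntrinsicBF.bayesFactor (X k) (e k)) 0) ∧
      -- sampling from the full model
      (∀ (β : ∀ k, Fin (p k) → ℝ) (σ : ℕ → ℝ) (δ : ℝ), (∀ k, 0 < σ k) →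
        Tendsto (fun k => IntrinsicBF.modelDistance (X k) (e k) (β k) (σ k)) atTop (𝓝 δ) →
        (IntrinsicBF.deltaBound r < δ →
          IntrinsicBF.TendstoInProbAtTop
            (fun k => IntrinsicBF.samplingLaw (X k) (β k) (σ k))
            (fun k => IntrinsicBF.bayesFactor (X k) (e k))) ∧
        (δ < IntrinsicBF.deltaBound r →
          IntrinsicBF.TendstoInProb
            (fun k => IntrinsicBF.samplingLaw (X k) (β k) (σ k))
            (fun k => IntrinsicBF.bayesFactor (X k) (e k)) 0))) ∧
    -- the threshold function on `(1, ∞)`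
    StrictAntiOn IntrinsicBF.deltaBound (Set.Ioi 1) ∧
    ConvexOn ℝ (Set.Ioi 1) IntrinsicBF.deltaBound ∧
    Tendsto IntrinsicBF.deltaBound atTop (𝓝 0) := by
  refine ⟨?_, IntrinsicBF.strictAntiOn_deltaBound, IntrinsicBF.strictConvexOn_deltaBound.convexOn,
    IntrinsicBF.tendsto_deltaBound⟩
  intro n p i X e a r hn hX _ ha1 hi _ hnp hr
  have hN : Tendsto (fun k => (n k : ℝ)) atTop atTop := tendsto_natCast_atTop_atTop.comp hn
  have hip : ∀ k, i k ≤ p k := fun k => by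
    simpa using Fintype.card_le_of_embedding (e k)
  have hpn : ∀ k, p k ≤ n k := fun k => by
    simpa using (hX k).fintype_card_le_finrank
  have hp : Tendsto (fun k => (p k : ℝ) / n k) atTop (𝓝 (1 / r)) := by
    simpa using hnp.inv₀ (by linarith)
  have hi0 : Tendsto (fun k => (i k : ℝ) / n k) atTop (𝓝 0) := by
    have h1 : (fun x : ℝ => x ^ a) =o[atTop] fun x : ℝ => x := by
      refine (isLittleO_iff_tendsto' ?_).2 ?_
      · filter_upwards [eventually_gt_atTop 0] with x hx h using absurd h hx.ne'
      · refine (tendsto_rpow_neg_atTop (sub_pos.2 ha1)).congr' ?_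
        filter_upwards [eventually_gt_atTop 0] with x hx
        rw [neg_sub, Real.rpow_sub_one hx.ne']
    exact (hi.trans_isLittleO (h1.comp_tendsto hN)).tendsto_div_nhds_zero
  refine ⟨fun α σ hσ => ?_, fun β σ δ hσ hδ => ?_⟩
  -- Sampling from the reduced model is sampling from the full model at distance `0`.
  · choose β hβ using fun k => IntrinsicBF.exists_mulVec_eq_subDesign_mulVec (X k) (e k) (α k)
    have hlaw : (fun k => IntrinsicBF.samplingLaw (IntrinsicBF.subDesign (X k) (e k)) (α k) (σ k)) =
        fun k => IntrinsicBF.samplingLaw (X k) (β k) (σ k) := by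
      ext1 k
      rw [IntrinsicBF.samplingLaw, IntrinsicBF.samplingLaw, hβ]
    have hδ : Tendsto (fun k => IntrinsicBF.modelDistance (X k) (e k) (β k) (σ k)) atTop (𝓝 0) := by
      refine tendsto_const_nhds.congr fun k => ?_
      rw [IntrinsicBF.modelDistance_eq, hβ, IntrinsicBF.one_sub_hatMatrix_mulVec_mulVec
        (IntrinsicBF.linearIndependent_subDesign (hX k) (e k)), dotProduct_zero, zero_div]
    rw [hlaw]
    exact IntrinsicBF.tendstoInProb_bayesFactor_zero hn hX hip hpn hp hi0 hr hσ hδ le_rfl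
      (IntrinsicBF.deltaBound_pos hr)
  · have hδ0 : 0 ≤ δ := ge_of_tendsto' hδ fun k => IntrinsicBF.modelDistance_nonneg (hX k) _ _ _
    exact ⟨IntrinsicBF.tendstoInProbAtTop_bayesFactor hn hX hip hpn hp hi0 hr hσ hδ hδ0,
      IntrinsicBF.tendstoInProb_bayesFactor_zero hn hX hip hpn hp hi0 hr hσ hδ hδ0⟩
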